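/- Let $\mathcal X\in\mathbb R^{n_1\times n_2\times n_3}$ and let $\lambda,\mu_1,\mu_2>0$. For $\mathcal A\in\mathbb R^{n_1\times n_2\times n_3}$ let $\|\mathcal A\|_F$ be the Frobenius norm, $\langle\cdot,\cdot\rangle$ the associated inner product, $\|\mathcal A\|_1=\sum_{ijk}|a_{ijk}|$, and $\|\mathcal A\|_*=\frac1{n_3}\sum_{i=1}^{n_3}\|\overline{\mathbf A}^{(i)}\|_*$, where $\overline{\mathbf A}^{(i)}$ are the frontal slices of the (unnormalized) discrete Fourier transform of $\mathcal A$ along the third dimension and the nuclear norm of a matrix is the sum of its singular values. For $\mathcal H\ne\mathcal O$ put $$L_1(\mathcal L,\mathcal H,\mathcal E,\mathcal Y,\mathcal Z)=\frac{\|\mathcal L\|_*}{\|\mathcal H\|_F}+\lambda\|\mathcal E\|_1+\frac{\mu_1}{2}\|\mathcal L-\mathcal H\|_F^2+\langle\mathcal Y,\mathcal L-\mathcal H\rangle+\frac{\mu_2}{2}\|\mathcal L+\mathcal E-\mathcal X\|_F^2+\langle\mathcal Z,\mathcal L+\mathcal E-\mathcal X\rangle .$$ Let $\mathcal C^{(k)}=(\mathcal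 L^{(k)},\mathcal H^{(k)},\mathcal E^{(k)},\mathcal Y^{(k)},\mathcal Z^{(k)})$, $k\ge0$, be generated by the ADMM scheme $$\begin{aligned} \mathcal L^{(k+1)}&\in\arg\min_{\mathcal L}L_1(\mathcal L,\mathcal H^{(k)},\mathcal E^{(k)},\mathcal Y^{(k)},\mathcal Z^{(k)}),\\ \mathcal H^{(k+1)}&\in\arg\min_{\mathcal H\neq\mathcal O}L_1(\mathcal L^{(k+1)},\mathcal H,\mathcal E^{(k)},\mathcal Y^{(k)},\mathcal Z^{(k)}),\\ \mathcal E^{(k+1)}&\in\arg\min_{\mathcal E}L_1(\mathcal L^{(k+1)},\mathcal H^{(k+1)},\mathcal E,\mathcal Y^{(k)},\mathcal Z^{(k)}),\\ \mathcal Y^{(k+1)}&=\mathcal Y^{(k)}+\mu_1(\mathcal L^{(k+1)}-\mathcal H^{(k+1)}),\qquad \mathcal Z^{(k+1)}=\mathcal Z^{(k)}+\mu_2(\mathcal L^{(k+1)}+\mathcal E^{(k+1)}-\mathcal X) \end{aligned}$$ from a starting point with $\mathcal H^{(0)}\ne\mathcal O$. Assume that A1: $\{\mathcal L^{(k)}\}$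 is bounded and $\|\mathcal L^{(k)}\|_*\le M$ for all $k$; A2: there is $\delta>0$ with $\|\mathcal H^{(k)}\|_F\ge\delta$ for all $k$. Then: (i) the sequences $\{\mathcal H^{(k)}\}$, $\{\mathcal E^{(k)}\}$, $\{\mathcal Y^{(k)}\}$ and $\{\mathcal Z^{(k)}\}$ are bounded; (ii) $\{\mathcal C^{(k)}\}$ has a convergent subsequence. It can be chosen so that the following holds: if $\mu_1,\mu_2$ are sufficiently large, in the sense that $$\frac{\mu_1+\mu_2}{2}-\frac{2\min\{n_1,n_2\}}{\mu_1\delta^4}>0\qquad\text{and}\qquad \frac{\mu_1}{2}-\frac{3M}{\delta^3}-\frac{4M^2}{\mu_1\delta^6}>0,$$ and if $\lim_{k\to\infty}\|\mathcal Z^{(k+1)}-\mathcal Z^{(k)}\|_F=0$, then its limit $\mathcal C^*=(\mathcal L^*,\mathcal H^*,\mathcal E^*,\mathcal Y^*,\mathcal Z^*)$ is a critical point of $L_1$, that is, $\mathcal H^*\ne\mathcal O$ and $0\in\partial L_1(\mathcal C^*)$, where $\partial$ is the limiting (Mordukhovich) subdifferential in all five variables jointly. -/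

import Mathlib

namespace TNF

noncomputable section

/-- Real third-order tensors of size `n₁ × n₂ × n₃`.  The norm of this Euclidean space is the
tensor Frobenius norm and its inner product is the sum of the products of the entries. -/
abbrev Tensor (n₁ n₂ n₃ : ℕ) : Type :=
  EuclideanSpace ℝ (Fin n₁ × Fin n₂ × Fin n₃)

/-- The `k`-th frontal slice of the discrete Fourier transform of `A` along the third
(tubal) dimension; indices start at zero, so the `k`-th slice is
`∑ l, exp (-2πi k l / n₃) A(:, :, l)`. -/
def fourierSlice {n₁ n₂ n₃ : ℕ} (A : Tensor n₁ n₂ n₃) (k : Fin n₃) :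
    Matrix (Fin n₁) (Fin n₂) ℂ :=
  Matrix.of fun i j => ∑ l : Fin n₃,
    Complex.exp (-2 * (Real.pi : ℂ) * Complex.I * ((k : ℕ) : ℂ) * ((l : ℕ) : ℂ) / (n₃ : ℂ)) *
      ((A (i, j, l) : ℝ) : ℂ)

/-- The nuclear norm of a complex matrix: the sum of its `min n₁ n₂` singular values. -/
def matrixNuclearNorm {n₁ n₂ : ℕ} (B : Matrix (Fin n₁) (Fin n₂) ℂ) : ℝ :=
  ∑ j ∈ Finset.range (min n₁ n₂), (Matrix.toEuclideanLin B).singularValues j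

/-- The tensor nuclear norm: the average over the frontal slices in the Fourier domain of their
matrix nuclear norms. -/
def nuclearNorm {n₁ n₂ n₃ : ℕ} (A : Tensor n₁ n₂ n₃) : ℝ :=
  (1 / (n₃ : ℝ)) * ∑ k : Fin n₃, matrixNuclearNorm (fourierSlice A k)

/-- The entrywise `ℓ₁` norm of a tensor. -/
def l1Norm {n₁ n₂ n₃ : ℕ} (A : Tensor n₁ n₂ n₃) : ℝ :=
  ∑ p, |A p|

/-- The augmented Lagrangian `L₁(L, H, E, Y, Z)`.  It is meaningful on its domain `H ≠ 0`. -/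
def augLagrangian {n₁ n₂ n₃ : ℕ} (X : Tensor n₁ n₂ n₃) (lam μ₁ μ₂ : ℝ)
    (L H E Y Z : Tensor n₁ n₂ n₃) : ℝ :=
  nuclearNorm L / ‖H‖ + lam * l1Norm E
    + μ₁ / 2 * ‖L - H‖ ^ 2 + inner ℝ Y (L - H)
    + μ₂ / 2 * ‖L + E - X‖ ^ 2 + inner ℝ Z (L + E - X)

/-- The five sequences are generated by the ADMM scheme for the TNF model, from an arbitrary
starting point in the domain.  Each `arg min` is read as membership in the set of global
minimizers; the minimization over `H` runs over the domain `H ≠ 0` of the Lagrangian. -/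
structure IsADMM {n₁ n₂ n₃ : ℕ} (X : Tensor n₁ n₂ n₃) (lam μ₁ μ₂ : ℝ)
    (L H E Y Z : ℕ → Tensor n₁ n₂ n₃) : Prop where
  H_ne_zero : ∀ k, H k ≠ 0
  L_update : ∀ k, ∀ A : Tensor n₁ n₂ n₃,
    augLagrangian X lam μ₁ μ₂ (L (k + 1)) (H k) (E k) (Y k) (Z k) ≤
      augLagrangian X lam μ₁ μ₂ A (H k) (E k) (Y k) (Z k)
  H_update : ∀ k, ∀ A : Tensor n₁ n₂ n₃, A ≠ 0 →
    augLagrangian X lam μ₁ μ₂ (L (k + 1)) (H (k + 1)) (E k) (Y k) (Z k) ≤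
      augLagrangian X lam μ₁ μ₂ (L (k + 1)) A (E k) (Y k) (Z k)
  E_update : ∀ k, ∀ A : Tensor n₁ n₂ n₃,
    augLagrangian X lam μ₁ μ₂ (L (k + 1)) (H (k + 1)) (E (k + 1)) (Y k) (Z k) ≤
      augLagrangian X lam μ₁ μ₂ (L (k + 1)) (H (k + 1)) A (Y k) (Z k)
  Y_update : ∀ k, Y (k + 1) = Y k + μ₁ • (L (k + 1) - H (k + 1))
  Z_update : ∀ k, Z (k + 1) = Z k + μ₂ • (L (k + 1) + E (k + 1) - X)

/-- The Hilbert space of five-tuples of tensors. -/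
abbrev State (n₁ n₂ n₃ : ℕ) : Type :=
  PiLp 2 (fun _ : Fin 5 => Tensor n₁ n₂ n₃)

/-- The five-tuple `(L, H, E, Y, Z)`. -/
def mkState {n₁ n₂ n₃ : ℕ} (L H E Y Z : Tensor n₁ n₂ n₃) : State n₁ n₂ n₃ :=
  WithLp.toLp 2 ![L, H, E, Y, Z]

/-- The augmented Lagrangian as a function of the five-tuple `(L, H, E, Y, Z)`. -/
def stateLagrangian {n₁ n₂ n₃ : ℕ} (X : Tensor n₁ n₂ n₃) (lam μ₁ μ₂ : ℝ)
    (C : State n₁ n₂ n₃) : ℝ :=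
  augLagrangian X lam μ₁ μ₂ (C 0) (C 1) (C 2) (C 3) (C 4)

/-- The regular (Fréchet) subdifferential: all `v` such that
`liminf_{y → x, y ≠ x} (f y - f x - ⟪v, y - x⟫) / ‖y - x‖ ≥ 0`. -/
def regularSubdifferential {V : Type*} [NormedAddCommGroup V] [InnerProductSpace ℝ V]
    (f : V → ℝ) (x : V) : Set V :=
  {v | ∀ ε > 0, ∀ᶠ y in nhds x, f x + inner ℝ v (y - x) - ε * ‖y - x‖ ≤ f y}

/-- The limiting (Mordukhovich) subdifferential. -/
def limitingSubdifferential {V : Type*} [NormedAddCommGroup V] [InnerProductSpace ℝ V]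
    (f : V → ℝ) (x : V) : Set V :=
  {v | ∃ xs vs : ℕ → V,
    Filter.Tendsto xs Filter.atTop (nhds x) ∧
    Filter.Tendsto (fun i => f (xs i)) Filter.atTop (nhds (f x)) ∧
    (∀ i, vs i ∈ regularSubdifferential f (xs i)) ∧
    Filter.Tendsto vs Filter.atTop (nhds v)}

/-- A critical point of the augmented Lagrangian: a point of its domain `H ≠ 0` at which zero is
a limiting subgradient with respect to all five variables jointly. -/
def IsCriticalPoint {n₁ n₂ n₃ : ℕ} (X : Tensor n₁ n₂ n₃) (lam μ₁ μ₂ : ℝ)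
    (C : State n₁ n₂ n₃) : Prop :=
  C 1 ≠ 0 ∧ (0 : State n₁ n₂ n₃) ∈ limitingSubdifferential (stateLagrangian X lam μ₁ μ₂) C

end

end TNF

/-!
Optimality in the `H`-step and in the `E`-step identifies the multipliers after the first iteration:
`Y = -‖L‖_* H / ‖H‖³`, and `-Z` is a subgradient of `lam ‖·‖₁` at `E`. Both are therefore bounded,
and the multiplier updates then bound `H` and `E` in terms of `L`, `Y`, `Z` and `X`.

For criticality, one iteration changes the augmented Lagrangian as follows. The `L`-step is
strongly convex and decreases it by `(μ₁ + μ₂)/2 ‖ΔL‖²`, since the nuclear norm is convex. The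
`H`-step decreases it by `(μ₁/2 - M/(2δ³)) ‖ΔH‖²`, by the tangent inequality `inv_norm_ge` for
`1/‖·‖`. The multiplier updates increase it by `‖ΔY‖²/μ₁ + ‖ΔZ‖²/μ₂`. The formula for `Y`, the
Lipschitz constant `√(min n₁ n₂)` of the tensor nuclear norm and the Lipschitz constant `2/δ³` of
`x ↦ x/‖x‖³` bound `‖ΔY‖²` by `‖ΔL‖²` and `‖ΔH‖²` (`IsADMM.norm_Y_sub_sq_le`); the two conditions on
`μ₁` and `μ₂` make the resulting coefficients positive (`IsADMM.augLagrangian_descent`,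
`quadratic_coefficient_pos`).

Only `ΔZ → 0` is assumed, not summability of `‖ΔZ‖²`, so the differences need not vanish along the
whole sequence. But the Lagrangian is bounded below, so `ΔL` and `ΔH`, and with them `ΔE` and `ΔY`,
tend to zero along some subsequence (`exists_subseq_tendsto_zero_of_descent`), and the convergent
subsequence is extracted from it. There the optimality conditions of the three subproblems pass to
the limit (`IsADMM.isCriticalPoint_of_tendsto`), and they imply that zero is a regular, hence a
limiting, subgradient in all variables jointly (`zero_mem_regularSubdifferential_of_stationary`).

The nuclear norm enters through its duality with partial isometries
(`norm_sum_inner_le_sum_singularValues`, `sum_singularValues_eq_sum_inner`), which gives convexity,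
and through Parseval's identity `sum_norm_sq_dft`, which gives the Lipschitz constant.
-/

namespace TNF

/-! ### Singular value decomposition and the dual description of the nuclear norm -/

section LinearMap
variable {E F : Type*} [NormedAddCommGroup E] [InnerProductSpace ℂ E] [FiniteDimensional ℂ E]
  [NormedAddCommGroup F] [InnerProductSpace ℂ F] [FiniteDimensional ℂ F]

/-- The reduced singular value decomposition of a linear map, indexed by its rank: right singular
vectors `v`, left singular vectors `u`, and only the nonzero singular values. -/
theorem exists_singularValue_decomposition (T : E →ₗ[ℂ] F) :
    ∃ (v : Fin (Module.finrank ℂ T.range) → E) (u : Fin (Module.finrank ℂ T.range) → F),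
      Orthonormal ℂ v ∧ Orthonormal ℂ u ∧
      (∀ x, T x = ∑ i : Fin (Module.finrank ℂ T.range),
        ((T.singularValues i : ℝ) : ℂ) • inner ℂ (v i) x • u i) ∧
      ∀ i : Fin (Module.finrank ℂ T.range), T (v i) = ((T.singularValues i : ℝ) : ℂ) • u i := by
  have hle : Module.finrank ℂ T.range ≤ Module.finrank ℂ E := LinearMap.finrank_range_le T
  set b := T.isSymmetric_adjoint_comp_self.eigenvectorBasis rfl with hb
  have hin : ∀ i j, inner ℂ (T (b i)) (T (b j)) =
      if i = j then (((T.singularValues i : ℝ) ^ 2 : ℝ) : ℂ) else 0 := by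
    intro i j
    rw [← LinearMap.adjoint_inner_left, ← LinearMap.comp_apply, hb,
      LinearMap.IsSymmetric.apply_eigenvectorBasis, ← LinearMap.sq_singularValues_fin,
      inner_smul_left, orthonormal_iff_ite.mp (OrthonormalBasis.orthonormal _)]
    simp
  have hz : ∀ i : Fin (Module.finrank ℂ E), Module.finrank ℂ T.range ≤ i → T (b i) = 0 := by
    intro i hi
    have h0 := hin i i
    rw [T.singularValues_eq_zero_iff_le_finrank_range.mpr hi] at h0
    simpa using h0
  have hpos : ∀ i : Fin (Module.finrank ℂ T.range), (0 : ℝ) < T.singularValues i :=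
    fun i => T.singularValues_pos_iff_lt_finrank_range.mpr i.2
  have hTv : ∀ i : Fin (Module.finrank ℂ T.range), T (b (Fin.castLE hle i)) =
      ((T.singularValues i : ℝ) : ℂ) •
        (((T.singularValues i : ℝ) : ℂ)⁻¹ • T (b (Fin.castLE hle i))) := by
    intro i
    rw [smul_smul, mul_inv_cancel₀ (by exact_mod_cast (hpos i).ne'), one_smul]
  refine ⟨fun i => b (Fin.castLE hle i),
    fun i => ((T.singularValues i : ℝ) : ℂ)⁻¹ • T (b (Fin.castLE hle i)),
    b.orthonormal.comp _ (Fin.castLE_injective hle), ?_, ?_, hTv⟩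
  · rw [orthonormal_iff_ite]
    intro i j
    rw [inner_smul_left, inner_smul_right, hin]
    have := (hpos i).ne'
    by_cases h : i = j
    · subst h
      simp only [if_true, Fin.val_castLE]
      rw [← Complex.ofReal_inv, Complex.conj_ofReal, ← Complex.ofReal_mul, ← Complex.ofReal_mul]
      field_simp
      simp
    · simp [h, (Fin.castLE_injective hle).ne h]
  · intro x
    conv_lhs => rw [← b.sum_repr' x, map_sum]
    simp only [map_smul]
    rw [← Finset.sum_subset (Finset.subset_univ (Finset.univ.map (Fin.castLEEmb hle)))]
    · rw [Finset.sum_map]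
      refine Finset.sum_congr rfl fun i _ => ?_
      conv_lhs => rw [Fin.castLEEmb_apply, hTv i]
      rw [smul_comm]
    · intro i _ hi
      rw [hz i, smul_zero]
      by_contra hlt
      exact hi (Finset.mem_map.mpr ⟨⟨i, not_le.mp hlt⟩, Finset.mem_univ _, by ext; simp⟩)

/-- Singular values beyond the rank vanish, so truncating their sequence anywhere past the rank
gives the same sum. -/
theorem sum_range_singularValues (T : E →ₗ[ℂ] F) {r : ℕ} (hr : Module.finrank ℂ T.range ≤ r) :
    ∑ j ∈ Finset.range r, T.singularValues j =
      ∑ i : Fin (Module.finrank ℂ T.range), T.singularValues i := by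
  rw [Fin.sum_univ_eq_sum_range (fun j => T.singularValues j)]
  refine (Finset.sum_subset (Finset.range_mono hr) fun j _ hj => ?_).symm
  exact T.singularValues_eq_zero_iff_le_finrank_range.mpr (by simpa using hj)

/-- One half of the duality between the nuclear and the spectral norm: pairing `T` with a partial
isometry, written as a pair of orthonormal families, never exceeds the sum of singular values. -/
theorem norm_sum_inner_le_sum_singularValues (T : E →ₗ[ℂ] F) {ι : Type*} [Fintype ι]
    {v : ι → E} {u : ι → F} (hv : Orthonormal ℂ v) (hu : Orthonormal ℂ u) :
    ‖∑ j, inner ℂ (u j) (T (v j))‖ ≤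
      ∑ i : Fin (Module.finrank ℂ T.range), T.singularValues i := by
  obtain ⟨p, q, hp, hq, hT, -⟩ := exists_singularValue_decomposition T
  simp only [hT, inner_sum, inner_smul_right]
  rw [Finset.sum_comm]
  refine (norm_sum_le _ _).trans (Finset.sum_le_sum fun i _ => ?_)
  rw [← Finset.mul_sum, norm_mul, Complex.norm_real,
    Real.norm_of_nonneg (T.singularValues_nonneg i)]
  refine mul_le_of_le_one_right (T.singularValues_nonneg i) ((norm_sum_le _ _).trans ?_)
  have h1 := hv.sum_inner_products_le (p i) (s := Finset.univ)
  have h2 := hu.sum_inner_products_le (q i) (s := Finset.univ)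
  rw [hp.1 i] at h1
  rw [hq.1 i] at h2
  calc ∑ j, ‖inner ℂ (p i) (v j) * inner ℂ (u j) (q i)‖
      ≤ ∑ j, (‖inner ℂ (v j) (p i)‖ ^ 2 + ‖inner ℂ (u j) (q i)‖ ^ 2) / 2 := by
        refine Finset.sum_le_sum fun j _ => ?_
        rw [norm_mul, norm_inner_symm]
        nlinarith [sq_nonneg (‖inner ℂ (v j) (p i)‖ - ‖inner ℂ (u j) (q i)‖)]
    _ ≤ 1 := by
        rw [← Finset.sum_div, Finset.sum_add_distrib]
        linarith

/-- The other half of the duality: the singular vectors attain the bound of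
`norm_sum_inner_le_sum_singularValues`. -/
theorem sum_singularValues_eq_sum_inner (T : E →ₗ[ℂ] F) :
    ∃ (v : Fin (Module.finrank ℂ T.range) → E) (u : Fin (Module.finrank ℂ T.range) → F),
      Orthonormal ℂ v ∧ Orthonormal ℂ u ∧
      ∑ i : Fin (Module.finrank ℂ T.range), T.singularValues i =
        (∑ i, inner ℂ (u i) (T (v i))).re := by
  obtain ⟨v, u, hv, hu, -, hT⟩ := exists_singularValue_decomposition T
  refine ⟨v, u, hv, hu, ?_⟩
  simp only [hT, inner_smul_right, inner_self_eq_norm_sq_to_K, hu.1]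
  simp

end LinearMap

section Matrix
variable {n₁ n₂ : ℕ}

theorem finrank_range_toEuclideanLin_le (B : Matrix (Fin n₁) (Fin n₂) ℂ) :
    Module.finrank ℂ (Matrix.toEuclideanLin B).range ≤ min n₁ n₂ := by
  refine le_min ?_ ?_
  · simpa using Submodule.finrank_le (Matrix.toEuclideanLin B).range
  · simpa using LinearMap.finrank_range_le (Matrix.toEuclideanLin B)

theorem matrixNuclearNorm_eq (B : Matrix (Fin n₁) (Fin n₂) ℂ) :
    matrixNuclearNorm B = ∑ i : Fin (Module.finrank ℂ (Matrix.toEuclideanLin B).range),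
      (Matrix.toEuclideanLin B).singularValues i :=
  sum_range_singularValues _ (finrank_range_toEuclideanLin_le B)

theorem matrixNuclearNorm_nonneg (B : Matrix (Fin n₁) (Fin n₂) ℂ) : 0 ≤ matrixNuclearNorm B :=
  Finset.sum_nonneg fun j _ => LinearMap.singularValues_nonneg _ j

/-- Sublinearity of the nuclear norm: the pair of orthonormal families that attains the left side
tests both summands on the right. -/
theorem matrixNuclearNorm_comb_le (A B : Matrix (Fin n₁) (Fin n₂) ℂ) {a b : ℝ} (ha : 0 ≤ a)
    (hb : 0 ≤ b) :
    matrixNuclearNorm ((a : ℂ) • A + (b : ℂ) • B) ≤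
      a * matrixNuclearNorm A + b * matrixNuclearNorm B := by
  obtain ⟨v, u, hv, hu, h⟩ := sum_singularValues_eq_sum_inner
    (Matrix.toEuclideanLin ((a : ℂ) • A + (b : ℂ) • B))
  have hA := (Complex.re_le_norm _).trans
    (norm_sum_inner_le_sum_singularValues (Matrix.toEuclideanLin A) hv hu)
  have hB := (Complex.re_le_norm _).trans
    (norm_sum_inner_le_sum_singularValues (Matrix.toEuclideanLin B) hv hu)
  rw [← matrixNuclearNorm_eq] at h hA hB
  rw [h]
  simp only [map_add, map_smul, LinearMap.add_apply, LinearMap.smul_apply, inner_add_right,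
    inner_smul_right, Finset.sum_add_distrib, ← Finset.mul_sum, Complex.add_re,
    Complex.re_ofReal_mul]
  exact add_le_add (mul_le_mul_of_nonneg_left hA ha) (mul_le_mul_of_nonneg_left hB hb)

/-- Comparison of the nuclear with the Frobenius norm. Each squared singular value is
`‖B v‖ ^ 2` for a right singular vector `v`, and Bessel's inequality for the rows of `B` bounds
their sum. -/
theorem matrixNuclearNorm_sq_le (B : Matrix (Fin n₁) (Fin n₂) ℂ) :
    matrixNuclearNorm B ^ 2 ≤ (min n₁ n₂ : ℕ) * ∑ i, ∑ j, ‖B i j‖ ^ 2 := by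
  set T := Matrix.toEuclideanLin B with hT
  obtain ⟨v, u, hv, hu, -, hTv⟩ := exists_singularValue_decomposition T
  have hσ : ∀ i : Fin (Module.finrank ℂ T.range), T.singularValues i ^ 2 = ‖T (v i)‖ ^ 2 := by
    intro i
    rw [hTv, norm_smul, hu.1, Complex.norm_real, mul_one, Real.norm_eq_abs, sq_abs]
  rw [matrixNuclearNorm_eq, ← hT]
  have h1 := sq_sum_le_card_mul_sum_sq (s := Finset.univ)
    (f := fun i : Fin (Module.finrank ℂ T.range) => T.singularValues i)
  refine h1.trans ?_
  rw [Finset.card_univ, Fintype.card_fin]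
  refine mul_le_mul (by exact_mod_cast finrank_range_toEuclideanLin_le B) ?_
    (Finset.sum_nonneg fun _ _ => sq_nonneg _) (by positivity)
  simp only [hσ, EuclideanSpace.norm_sq_eq]
  rw [Finset.sum_comm]
  refine Finset.sum_le_sum fun k _ => ?_
  -- the `k`-th entry of `B x` is an inner product with the conjugate of the `k`-th row
  have hrow : ∀ x, (T x) k = inner ℂ (WithLp.toLp 2 (fun j => star (B k j))) x := by
    intro x
    simp [hT, Matrix.toLpLin_apply, Matrix.mulVec, dotProduct, PiLp.inner_apply, mul_comm]
  have := hv.sum_inner_products_le (WithLp.toLp 2 (fun j => star (B k j))) (s := Finset.univ)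
  rw [EuclideanSpace.norm_sq_eq] at this
  simp only [hrow]
  simp_rw [norm_inner_symm (𝕜 := ℂ) (WithLp.toLp 2 (fun j => star (B k j)))]
  simpa using this

end Matrix

/-! ### Parseval's identity -/

section Fourier

/-- Orthogonality of the columns of the discrete Fourier matrix, from the geometric sum of a nontrivial
root of unity. -/
theorem sum_exp_mul_conj_exp {n : ℕ} (l m : Fin n) :
    ∑ k : Fin n,
      Complex.exp (-2 * (Real.pi : ℂ) * Complex.I * ((k : ℕ) : ℂ) * ((l : ℕ) : ℂ) / (n : ℂ)) *
      (starRingEnd ℂ) (Complex.exp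
        (-2 * (Real.pi : ℂ) * Complex.I * ((k : ℕ) : ℂ) * ((m : ℕ) : ℂ) / (n : ℂ))) =
      if l = m then (n : ℂ) else 0 := by
  have hn : (n : ℂ) ≠ 0 := by
    have : 0 < n := l.pos
    exact_mod_cast this.ne'
  set z : ℂ := Complex.exp (-2 * (Real.pi : ℂ) * Complex.I * (((l : ℕ) : ℂ) - ((m : ℕ) : ℂ)) / n)
    with hz
  have hterm : ∀ k : Fin n,
      Complex.exp (-2 * (Real.pi : ℂ) * Complex.I * ((k : ℕ) : ℂ) * ((l : ℕ) : ℂ) / (n : ℂ)) *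
      (starRingEnd ℂ) (Complex.exp
        (-2 * (Real.pi : ℂ) * Complex.I * ((k : ℕ) : ℂ) * ((m : ℕ) : ℂ) / (n : ℂ))) =
      z ^ (k : ℕ) := by
    intro k
    rw [← Complex.exp_conj, ← Complex.exp_add, hz, ← Complex.exp_nat_mul]
    congr 1
    simp only [map_div₀, map_mul, map_neg, Complex.conj_ofReal, Complex.conj_I, map_natCast,
      map_ofNat]
    ring
  rw [Finset.sum_congr rfl fun k _ => hterm k, Fin.sum_univ_eq_sum_range (fun j => z ^ j)]
  by_cases h : l = m
  · simp [hz, h]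
  · rw [if_neg h]
    have hzn : z ^ n = 1 := by
      rw [hz, ← Complex.exp_nat_mul, Complex.exp_eq_one_iff]
      refine ⟨(m : ℤ) - (l : ℤ), ?_⟩
      push_cast
      field_simp
      ring
    have hz1 : z ≠ 1 := by
      intro h1
      obtain ⟨j, hj⟩ := Complex.exp_eq_one_iff.mp h1
      have h2 : (m : ℂ) - (l : ℂ) = j * n := by
        have hpi := Complex.two_pi_I_ne_zero
        field_simp at hj
        apply mul_left_cancel₀ hpi
        linear_combination (2 * (Real.pi : ℂ) * Complex.I) * hj
      have h3 : ((m : ℕ) : ℤ) - ((l : ℕ) : ℤ) = j * n := by exact_mod_cast h2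
      have h4 : (n : ℤ) ∣ ((m : ℕ) : ℤ) - ((l : ℕ) : ℤ) := ⟨j, by rw [h3, mul_comm]⟩
      have h5 := Int.eq_zero_of_abs_lt_dvd h4 (by
        rw [abs_lt]
        have := l.2
        have := m.2
        constructor <;> omega)
      exact h (Fin.ext (by omega))
    have := geom_sum_mul z n
    rw [hzn, sub_self] at this
    exact (mul_eq_zero.mp this).resolve_right (sub_ne_zero.mpr hz1)

/-- Parseval's identity for the unnormalized discrete Fourier transform. -/
theorem sum_norm_sq_dft {n : ℕ} (a : Fin n → ℝ) :
    ∑ k : Fin n, ‖∑ l : Fin n,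
      Complex.exp (-2 * (Real.pi : ℂ) * Complex.I * ((k : ℕ) : ℂ) * ((l : ℕ) : ℂ) / (n : ℂ)) *
        (a l : ℂ)‖ ^ 2 = n * ∑ l, a l ^ 2 := by
  have key : ∀ x : ℂ, ((‖x‖ ^ 2 : ℝ) : ℂ) = x * (starRingEnd ℂ) x := by
    intro x
    rw [Complex.mul_conj, Complex.normSq_eq_norm_sq]
  apply Complex.ofReal_injective
  rw [Complex.ofReal_sum]
  simp only [key, map_sum, Finset.sum_mul_sum, map_mul, Complex.conj_ofReal]
  rw [Finset.sum_comm]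
  calc _ = ∑ l, ∑ m, ((a l : ℂ) * a m) * (if l = m then (n : ℂ) else 0) := by
        refine Finset.sum_congr rfl fun l _ => ?_
        rw [Finset.sum_comm]
        refine Finset.sum_congr rfl fun m _ => ?_
        rw [← sum_exp_mul_conj_exp, Finset.mul_sum]
        exact Finset.sum_congr rfl fun k _ => by ring
    _ = _ := by
        simp only [mul_ite, mul_zero, Finset.sum_ite_eq, Finset.mem_univ, if_true]
        push_cast
        rw [Finset.mul_sum]
        exact Finset.sum_congr rfl fun k _ => by ring

end Fourier

/-! ### Convexity and Lipschitz continuity of the tensor norms -/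

section NuclearNorm
variable {n₁ n₂ n₃ : ℕ}

theorem fourierSlice_comb (A B : Tensor n₁ n₂ n₃) (a b : ℝ) (k : Fin n₃) :
    fourierSlice (a • A + b • B) k = (a : ℂ) • fourierSlice A k + (b : ℂ) • fourierSlice B k := by
  ext i j
  simp only [fourierSlice, Matrix.of_apply, Matrix.add_apply, Matrix.smul_apply, smul_eq_mul,
    PiLp.add_apply, PiLp.smul_apply, Finset.mul_sum, ← Finset.sum_add_distrib]
  refine Finset.sum_congr rfl fun l _ => ?_
  push_cast
  ring

theorem sum_norm_sq_fourierSlice (A : Tensor n₁ n₂ n₃) :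
    ∑ k, ∑ i, ∑ j, ‖fourierSlice A k i j‖ ^ 2 = n₃ * ‖A‖ ^ 2 := by
  rw [EuclideanSpace.norm_sq_eq, Fintype.sum_prod_type, Finset.sum_comm, Finset.mul_sum]
  refine Finset.sum_congr rfl fun i _ => ?_
  rw [Fintype.sum_prod_type, Finset.sum_comm, Finset.mul_sum]
  refine Finset.sum_congr rfl fun j _ => ?_
  simp only [Real.norm_eq_abs, sq_abs]
  exact sum_norm_sq_dft fun l => A (i, j, l)

theorem nuclearNorm_nonneg (A : Tensor n₁ n₂ n₃) : 0 ≤ nuclearNorm A :=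
  mul_nonneg (by positivity) (Finset.sum_nonneg fun _ _ => matrixNuclearNorm_nonneg _)

theorem nuclearNorm_comb_le (A B : Tensor n₁ n₂ n₃) {a b : ℝ} (ha : 0 ≤ a) (hb : 0 ≤ b) :
    nuclearNorm (a • A + b • B) ≤ a * nuclearNorm A + b * nuclearNorm B := by
  have h : ∑ k, matrixNuclearNorm (fourierSlice (a • A + b • B) k) ≤
      ∑ k, (a * matrixNuclearNorm (fourierSlice A k) +
        b * matrixNuclearNorm (fourierSlice B k)) :=
    Finset.sum_le_sum fun k _ => by
      rw [fourierSlice_comb]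
      exact matrixNuclearNorm_comb_le _ _ ha hb
  rw [Finset.sum_add_distrib, ← Finset.mul_sum, ← Finset.mul_sum] at h
  unfold nuclearNorm
  refine (mul_le_mul_of_nonneg_left h (by positivity : (0 : ℝ) ≤ 1 / (n₃ : ℝ))).trans (le_of_eq ?_)
  ring

theorem convexOn_nuclearNorm :
    ConvexOn ℝ Set.univ (nuclearNorm : Tensor n₁ n₂ n₃ → ℝ) :=
  ⟨convex_univ, fun A _ B _ _ _ ha hb _ => nuclearNorm_comb_le A B ha hb⟩

/-- The factor `n₃` of the unnormalized Parseval identity cancels against the average over slices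
and the Cauchy-Schwarz inequality, which leaves the matrix constant `√(min n₁ n₂)`. -/
theorem nuclearNorm_le (A : Tensor n₁ n₂ n₃) :
    nuclearNorm A ≤ √(min n₁ n₂ : ℕ) * ‖A‖ := by
  refine le_of_sq_le_sq ?_ (by positivity)
  rw [mul_pow, Real.sq_sqrt (by positivity)]
  rcases Nat.eq_zero_or_pos n₃ with h3 | h3
  · subst h3
    simp only [nuclearNorm, Finset.univ_eq_empty, Finset.sum_empty, mul_zero]
    rw [zero_pow two_ne_zero]
    positivity
  have h3' : (0 : ℝ) < n₃ := by exact_mod_cast h3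
  have h1 := sq_sum_le_card_mul_sum_sq (s := Finset.univ)
    (f := fun k => matrixNuclearNorm (fourierSlice A k))
  rw [Finset.card_univ, Fintype.card_fin] at h1
  have h2 : ∑ k, matrixNuclearNorm (fourierSlice A k) ^ 2 ≤
      (min n₁ n₂ : ℕ) * (n₃ * ‖A‖ ^ 2) := by
    rw [← sum_norm_sq_fourierSlice, Finset.mul_sum]
    exact Finset.sum_le_sum fun k _ => matrixNuclearNorm_sq_le _
  have h4 := h1.trans (mul_le_mul_of_nonneg_left h2 h3'.le)
  unfold nuclearNorm
  rw [mul_pow, one_div, inv_pow, inv_mul_le_iff₀ (by positivity)]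
  refine h4.trans (le_of_eq ?_)
  ring

theorem abs_nuclearNorm_sub_le (A B : Tensor n₁ n₂ n₃) :
    |nuclearNorm A - nuclearNorm B| ≤ √(min n₁ n₂ : ℕ) * ‖A - B‖ := by
  have key : ∀ A B : Tensor n₁ n₂ n₃,
      nuclearNorm A - nuclearNorm B ≤ √(min n₁ n₂ : ℕ) * ‖A - B‖ := by
    intro A B
    have h := nuclearNorm_comb_le B (A - B) zero_le_one zero_le_one
    simp only [one_smul, add_sub_cancel, one_mul] at h
    linarith [nuclearNorm_le (A - B)]
  refine abs_sub_le_iff.mpr ⟨key A B, ?_⟩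
  rw [norm_sub_rev]
  exact key B A

theorem continuous_nuclearNorm : Continuous (nuclearNorm : Tensor n₁ n₂ n₃ → ℝ) := by
  refine LipschitzWith.continuous (K := Real.toNNReal √(min n₁ n₂ : ℕ))
    (LipschitzWith.of_dist_le_mul fun A B => ?_)
  rw [Real.dist_eq, dist_eq_norm, Real.coe_toNNReal _ (Real.sqrt_nonneg _)]
  exact abs_nuclearNorm_sub_le A B

end NuclearNorm

section EntrywiseNorm
variable {n₁ n₂ n₃ : ℕ}

theorem l1Norm_nonneg (A : Tensor n₁ n₂ n₃) : 0 ≤ l1Norm A :=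
  Finset.sum_nonneg fun _ _ => abs_nonneg _

theorem l1Norm_add_le (A B : Tensor n₁ n₂ n₃) : l1Norm (A + B) ≤ l1Norm A + l1Norm B := by
  simp only [l1Norm, ← Finset.sum_add_distrib]
  exact Finset.sum_le_sum fun p _ => abs_add_le _ _

theorem l1Norm_smul (a : ℝ) (A : Tensor n₁ n₂ n₃) : l1Norm (a • A) = |a| * l1Norm A := by
  simp [l1Norm, Finset.mul_sum, abs_mul]

theorem convexOn_l1Norm : ConvexOn ℝ Set.univ (l1Norm : Tensor n₁ n₂ n₃ → ℝ) := by
  refine ⟨convex_univ, fun A _ B _ a b ha hb _ => (l1Norm_add_le _ _).trans (le_of_eq ?_)⟩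
  rw [l1Norm_smul, l1Norm_smul, abs_of_nonneg ha, abs_of_nonneg hb, smul_eq_mul, smul_eq_mul]

theorem continuous_l1Norm : Continuous (l1Norm : Tensor n₁ n₂ n₃ → ℝ) := by
  unfold l1Norm
  fun_prop

theorem l1Norm_le (A : Tensor n₁ n₂ n₃) :
    l1Norm A ≤ Fintype.card (Fin n₁ × Fin n₂ × Fin n₃) * ‖A‖ := by
  unfold l1Norm
  refine (Finset.sum_le_card_nsmul _ _ ‖A‖ fun p _ => ?_).trans (by simp)
  exact PiLp.norm_apply_le A p

end EntrywiseNorm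

/-! ### The inverse norm on an inner product space -/

section InverseNorm
variable {V : Type*} [NormedAddCommGroup V] [InnerProductSpace ℝ V]

/-- The function `x ↦ 1 / ‖x‖` lies above its tangent at `x` up to a quadratic error with constant
`1 / (2‖x‖³)`. This holds for every `y ≠ 0`, also when the segment from `x` to `y` passes close to
the origin, where no bound on the Hessian is available. -/
theorem inv_norm_ge {x y : V} (hx : x ≠ 0) (hy : y ≠ 0) :
    1 / ‖x‖ - inner ℝ x (y - x) / ‖x‖ ^ 3 - ‖y - x‖ ^ 2 / (2 * ‖x‖ ^ 3) ≤ 1 / ‖y‖ := by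
  have ha := norm_pos_iff.mpr hx
  have hb := norm_pos_iff.mpr hy
  have h1 : inner ℝ x (y - x) = (‖y‖ ^ 2 - ‖x‖ ^ 2 - ‖y - x‖ ^ 2) / 2 := by
    rw [norm_sub_sq_real, inner_sub_right, real_inner_self_eq_norm_sq, real_inner_comm]
    ring
  rw [h1, ← sub_nonneg]
  -- With `a = ‖x‖` and `b = ‖y‖` the difference is `(b - a)² (b + 2a) / (2a³b)`.
  have h2 : 1 / ‖y‖ - (1 / ‖x‖ - (‖y‖ ^ 2 - ‖x‖ ^ 2 - ‖y - x‖ ^ 2) / 2 / ‖x‖ ^ 3 -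
      ‖y - x‖ ^ 2 / (2 * ‖x‖ ^ 3)) =
      (‖y‖ - ‖x‖) ^ 2 * (‖y‖ + 2 * ‖x‖) / (2 * ‖x‖ ^ 3 * ‖y‖) := by
    field_simp
    ring
  rw [h2]
  positivity

/-- The map `x ↦ x / ‖x‖³` is Lipschitz with constant `2 / δ³` on the (nonconvex) set `δ ≤ ‖x‖`. -/
theorem norm_smul_inv_cube_sub_le {x y : V} {δ : ℝ} (hδ : 0 < δ) (hx : δ ≤ ‖x‖) (hy : δ ≤ ‖y‖) :
    ‖(‖x‖ ^ 3)⁻¹ • x - (‖y‖ ^ 3)⁻¹ • y‖ ≤ 2 / δ ^ 3 * ‖x - y‖ := by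
  have ha : 0 < ‖x‖ := hδ.trans_le hx
  have hb : 0 < ‖y‖ := hδ.trans_le hy
  refine le_of_sq_le_sq ?_ (by positivity)
  have h1 : ‖(‖x‖ ^ 3)⁻¹ • x - (‖y‖ ^ 3)⁻¹ • y‖ ^ 2 =
      ‖x - y‖ ^ 2 * (1 / (‖x‖ ^ 3 * ‖y‖ ^ 3)) +
      (‖x‖ - ‖y‖) ^ 2 * (1 / (‖x‖ ^ 2 * ‖y‖ ^ 4) + 1 / (‖x‖ ^ 3 * ‖y‖ ^ 3)
        + 1 / (‖x‖ ^ 4 * ‖y‖ ^ 2)) := by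
    rw [norm_sub_sq_real, norm_sub_sq_real, norm_smul, norm_smul, real_inner_smul_left,
      real_inner_smul_right, norm_inv, norm_inv, norm_pow, norm_pow, norm_norm, norm_norm]
    field_simp
    ring
  have h2 : (‖x‖ - ‖y‖) ^ 2 ≤ ‖x - y‖ ^ 2 := by
    rw [← sq_abs]
    exact pow_le_pow_left₀ (abs_nonneg _) (abs_norm_sub_norm_le x y) 2
  have h3 : ∀ i j : ℕ, i + j = 6 → 1 / (‖x‖ ^ i * ‖y‖ ^ j) ≤ 1 / δ ^ 6 := by
    intro i j hij
    rw [← hij, pow_add]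
    gcongr
  calc _ ≤ ‖x - y‖ ^ 2 * (1 / δ ^ 6) + ‖x - y‖ ^ 2 * (1 / δ ^ 6 + 1 / δ ^ 6 + 1 / δ ^ 6) := by
        rw [h1]
        gcongr ?_ * ?_ + ?_ * (?_ + ?_ + ?_)
        · exact h3 3 3 rfl
        · exact h3 2 4 rfl
        · exact h3 3 3 rfl
        · exact h3 4 2 rfl
    _ = _ := by
        field_simp
        ring

theorem norm_norm_inv_cube_smul (x : V) : ‖(‖x‖ ^ 3)⁻¹ • x‖ = (‖x‖ ^ 2)⁻¹ := by
  rcases eq_or_ne x 0 with rfl | hx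
  · simp
  have := norm_pos_iff.mpr hx
  rw [norm_smul, norm_inv, norm_pow, norm_norm]
  field_simp

theorem hasFDerivAt_inv_norm {x : V} (hx : x ≠ 0) :
    HasFDerivAt (fun y : V => 1 / ‖y‖) (-((‖x‖ ^ 3)⁻¹ • innerSL ℝ x)) x := by
  have ha := norm_pos_iff.mpr hx
  have h1 : HasFDerivAt (fun y : V => ‖y‖ ^ 2) (2 • innerSL ℝ x) x :=
    (hasStrictFDerivAt_norm_sq x).hasFDerivAt
  have h2 := h1.sqrt (by positivity)
  simp only [Real.sqrt_sq (norm_nonneg _)] at h2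
  have h3 := (hasDerivAt_inv ha.ne').comp_hasFDerivAt x h2
  simp only [one_div]
  refine h3.congr_fderiv ?_
  ext v
  simp
  field_simp

/-- First-order optimality for a convex function: a quadratic perturbation of a subgradient
inequality can be dropped, because at distance `t` along a segment it is of order `t ^ 2`. -/
theorem le_add_inner_of_le_add_sq {g : V → ℝ} (hg : ConvexOn ℝ Set.univ g) {x w : V}
    {c : ℝ} (h : ∀ y, g x ≤ g y + inner ℝ w (y - x) + c * ‖y - x‖ ^ 2) (y : V) :
    g x ≤ g y + inner ℝ w (y - x) := by
  have key : ∀ t : ℝ, 0 < t → t ≤ 1 →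
      0 ≤ g y - g x + inner ℝ w (y - x) + t * (c * ‖y - x‖ ^ 2) := by
    intro t ht ht1
    have h1 := h ((1 - t) • x + t • y)
    have h2 := hg.2 (Set.mem_univ x) (Set.mem_univ y) (by linarith : 0 ≤ 1 - t) ht.le (by ring)
    have h3 : (1 - t) • x + t • y - x = t • (y - x) := by module
    rw [h3, inner_smul_right, norm_smul, mul_pow, Real.norm_eq_abs, sq_abs] at h1
    simp only [smul_eq_mul] at h2
    have h4 : 0 ≤ t * (g y - g x + inner ℝ w (y - x) + t * (c * ‖y - x‖ ^ 2)) := by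
      linarith
    exact nonneg_of_mul_nonneg_right h4 ht
  have hlim : Filter.Tendsto
      (fun t : ℝ => g y - g x + inner ℝ w (y - x) + t * (c * ‖y - x‖ ^ 2))
      (nhdsWithin 0 (Set.Ioi 0)) (nhds (g y - g x + inner ℝ w (y - x) + 0 * (c * ‖y - x‖ ^ 2))) :=
    ((continuous_const.add (continuous_id.mul continuous_const)).tendsto 0).mono_left
      nhdsWithin_le_nhds
  have := ge_of_tendsto hlim (Filter.mem_of_superset
    (Ioc_mem_nhdsGT (zero_lt_one' ℝ)) fun t ht => key t ht.1 ht.2)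
  linarith

end InverseNorm

/-! ### The three subproblems -/

section Subproblems
variable {n₁ n₂ n₃ : ℕ} {X L H E Y Z : Tensor n₁ n₂ n₃} {lam μ₁ μ₂ : ℝ}

/-- Exact expansion of the Lagrangian in its first variable; the quadratic terms combine to
curvature `μ₁ + μ₂`. -/
theorem augLagrangian_eq_of_L (A : Tensor n₁ n₂ n₃) :
    augLagrangian X lam μ₁ μ₂ A H E Y Z = augLagrangian X lam μ₁ μ₂ L H E Y Z
      + (nuclearNorm A / ‖H‖ - nuclearNorm L / ‖H‖)
      + inner ℝ (Y + Z + μ₁ • (L - H) + μ₂ • (L + E - X)) (A - L)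
      + (μ₁ + μ₂) / 2 * ‖A - L‖ ^ 2 := by
  have h1 : A - H = (L - H) + (A - L) := by abel
  have h2 : A + E - X = (L + E - X) + (A - L) := by abel
  unfold augLagrangian
  rw [h1, h2, norm_add_sq_real, norm_add_sq_real]
  simp only [inner_add_left, inner_add_right, real_inner_smul_left]
  ring

theorem augLagrangian_eq_of_E (A : Tensor n₁ n₂ n₃) :
    augLagrangian X lam μ₁ μ₂ L H A Y Z = augLagrangian X lam μ₁ μ₂ L H E Y Z
      + (lam * l1Norm A - lam * l1Norm E)
      + inner ℝ (Z + μ₂ • (L + E - X)) (A - E) + μ₂ / 2 * ‖A - E‖ ^ 2 := by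
  have h2 : L + A - X = (L + E - X) + (A - E) := by abel
  unfold augLagrangian
  rw [h2, norm_add_sq_real]
  simp only [inner_add_left, inner_add_right, real_inner_smul_left]
  ring

theorem augLagrangian_eq_of_H (A : Tensor n₁ n₂ n₃) :
    augLagrangian X lam μ₁ μ₂ L A E Y Z = augLagrangian X lam μ₁ μ₂ L H E Y Z
      + nuclearNorm L * (1 / ‖A‖ - 1 / ‖H‖)
      - inner ℝ (Y + μ₁ • (L - H)) (A - H) + μ₁ / 2 * ‖A - H‖ ^ 2 := by
  have h1 : L - A = (L - H) - (A - H) := by abel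
  unfold augLagrangian
  rw [h1, norm_sub_sq_real]
  simp only [inner_add_left, inner_sub_right, real_inner_smul_left]
  ring

theorem augLagrangian_eq_of_YZ (Y' Z' : Tensor n₁ n₂ n₃) :
    augLagrangian X lam μ₁ μ₂ L H E Y' Z' = augLagrangian X lam μ₁ μ₂ L H E Y Z
      + inner ℝ (Y' - Y) (L - H) + inner ℝ (Z' - Z) (L + E - X) := by
  unfold augLagrangian
  rw [inner_sub_left, inner_sub_left]
  ring

/-- Optimality of a minimizer in `L`: minus the displayed vector is a subgradient of `‖·‖_* / ‖H‖`. -/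
theorem L_minimizer_le
    (h : ∀ A, augLagrangian X lam μ₁ μ₂ L H E Y Z ≤ augLagrangian X lam μ₁ μ₂ A H E Y Z)
    (A : Tensor n₁ n₂ n₃) :
    nuclearNorm L / ‖H‖ ≤ nuclearNorm A / ‖H‖
      + inner ℝ (Y + Z + μ₁ • (L - H) + μ₂ • (L + E - X)) (A - L) := by
  have hg : ConvexOn ℝ Set.univ (fun A : Tensor n₁ n₂ n₃ => nuclearNorm A / ‖H‖) := by
    have := (convexOn_nuclearNorm (n₁ := n₁) (n₂ := n₂) (n₃ := n₃)).smul
      (inv_nonneg.mpr (norm_nonneg H))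
    simpa only [div_eq_inv_mul, smul_eq_mul] using this
  refine le_add_inner_of_le_add_sq hg (c := (μ₁ + μ₂) / 2) (fun A => ?_) A
  have := h A
  rw [augLagrangian_eq_of_L (L := L) A] at this
  linarith

/-- Optimality of a minimizer in `E`: minus the updated multiplier is a subgradient of `lam ‖·‖₁`. -/
theorem E_minimizer_le (hlam : 0 ≤ lam)
    (h : ∀ A, augLagrangian X lam μ₁ μ₂ L H E Y Z ≤ augLagrangian X lam μ₁ μ₂ L H A Y Z)
    (A : Tensor n₁ n₂ n₃) :
    lam * l1Norm E ≤ lam * l1Norm A + inner ℝ (Z + μ₂ • (L + E - X)) (A - E) := by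
  have hg : ConvexOn ℝ Set.univ (fun A : Tensor n₁ n₂ n₃ => lam * l1Norm A) :=
    (convexOn_l1Norm (n₁ := n₁) (n₂ := n₂) (n₃ := n₃)).smul hlam
  refine le_add_inner_of_le_add_sq hg (c := μ₂ / 2) (fun A => ?_) A
  have := h A
  rw [augLagrangian_eq_of_E (E := E) A] at this
  linarith

/-- Optimality of a minimizer in `H`: the updated multiplier is the gradient at `H` of
`‖L‖_* / ‖·‖`. -/
theorem H_minimizer_eq (hH : H ≠ 0)
    (h : ∀ A, A ≠ 0 →
      augLagrangian X lam μ₁ μ₂ L H E Y Z ≤ augLagrangian X lam μ₁ μ₂ L A E Y Z) :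
    Y + μ₁ • (L - H) = -(nuclearNorm L • (‖H‖ ^ 3)⁻¹ • H) := by
  set w := Y + μ₁ • (L - H) with hw
  have hd : HasFDerivAt (fun A : Tensor n₁ n₂ n₃ => augLagrangian X lam μ₁ μ₂ L H E Y Z
      + nuclearNorm L * (1 / ‖A‖ - 1 / ‖H‖) - inner ℝ w (A - H) + μ₁ / 2 * ‖A - H‖ ^ 2)
      (nuclearNorm L • (-((‖H‖ ^ 3)⁻¹ • innerSL ℝ H)) - innerSL ℝ w) H := by
    have h1 := (((hasFDerivAt_inv_norm hH).sub_const (1 / ‖H‖)).const_mul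
      (nuclearNorm L)).const_add (augLagrangian X lam μ₁ μ₂ L H E Y Z)
    have h2 : HasFDerivAt (fun A => inner ℝ w (A - H)) (innerSL ℝ w) H :=
      (innerSL ℝ w).hasFDerivAt.comp H ((hasFDerivAt_id H).sub_const H)
    have h3 : HasFDerivAt (fun A => ‖A - H‖ ^ 2) (0 : Tensor n₁ n₂ n₃ →L[ℝ] ℝ) H := by
      have := ((hasFDerivAt_id H).sub_const H).norm_sq
      simpa using this
    refine ((h1.sub h2).add (h3.const_mul (μ₁ / 2))).congr_fderiv ?_
    rw [smul_zero, add_zero]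
  have hmin : IsLocalMin (fun A : Tensor n₁ n₂ n₃ => augLagrangian X lam μ₁ μ₂ L H E Y Z
      + nuclearNorm L * (1 / ‖A‖ - 1 / ‖H‖) - inner ℝ w (A - H) + μ₁ / 2 * ‖A - H‖ ^ 2) H := by
    filter_upwards [isOpen_ne.mem_nhds hH] with A hA
    rw [hw, ← augLagrangian_eq_of_H, ← augLagrangian_eq_of_H]
    exact h A hA
  have h0 := hmin.hasFDerivAt_eq_zero hd
  refine ext_inner_right ℝ fun v => ?_
  have := DFunLike.congr_fun h0 v
  simp only [sub_apply, smul_apply, neg_apply, zero_apply, innerSL_apply_apply, smul_eq_mul]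
    at this
  rw [inner_neg_left, real_inner_smul_left, real_inner_smul_left]
  linarith

theorem L_minimizer_decrease
    (h : ∀ A, augLagrangian X lam μ₁ μ₂ L H E Y Z ≤ augLagrangian X lam μ₁ μ₂ A H E Y Z)
    (A : Tensor n₁ n₂ n₃) :
    augLagrangian X lam μ₁ μ₂ L H E Y Z + (μ₁ + μ₂) / 2 * ‖A - L‖ ^ 2 ≤
      augLagrangian X lam μ₁ μ₂ A H E Y Z := by
  rw [augLagrangian_eq_of_L (L := L) A]
  linarith [L_minimizer_le h A]

/-- The `H`-subproblem is not convex, but the negative curvature of `‖L‖_* / ‖·‖` is controlled by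
`inv_norm_ge`. -/
theorem H_minimizer_decrease (hH : H ≠ 0)
    (h : ∀ A, A ≠ 0 →
      augLagrangian X lam μ₁ μ₂ L H E Y Z ≤ augLagrangian X lam μ₁ μ₂ L A E Y Z)
    {A : Tensor n₁ n₂ n₃} (hA : A ≠ 0) :
    augLagrangian X lam μ₁ μ₂ L H E Y Z
      + (μ₁ / 2 - nuclearNorm L / (2 * ‖H‖ ^ 3)) * ‖A - H‖ ^ 2 ≤
      augLagrangian X lam μ₁ μ₂ L A E Y Z := by
  rw [augLagrangian_eq_of_H (H := H) A, H_minimizer_eq hH h, inner_neg_left,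
    real_inner_smul_left, real_inner_smul_left]
  have h1 := mul_le_mul_of_nonneg_left (inv_norm_ge hH hA) (nuclearNorm_nonneg L)
  have h2 : nuclearNorm L * (1 / ‖H‖ - inner ℝ H (A - H) / ‖H‖ ^ 3
      - ‖A - H‖ ^ 2 / (2 * ‖H‖ ^ 3)) = nuclearNorm L * (1 / ‖H‖)
      - nuclearNorm L * ((‖H‖ ^ 3)⁻¹ * inner ℝ H (A - H))
      - nuclearNorm L / (2 * ‖H‖ ^ 3) * ‖A - H‖ ^ 2 := by ring
  linarith

end Subproblems

/-! ### Boundedness and descent of the iterates -/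

section Sequences

theorem isBounded_range_of_norm_succ_le {V : Type*} [SeminormedAddCommGroup V] {f : ℕ → V} {c : ℝ}
    (h : ∀ k, ‖f (k + 1)‖ ≤ c) : Bornology.IsBounded (Set.range f) := by
  refine isBounded_iff_forall_norm_le.mpr ⟨max ‖f 0‖ c, ?_⟩
  rintro _ ⟨k, rfl⟩
  cases k with
  | zero => exact le_max_left _ _
  | succ k => exact (h k).trans (le_max_right _ _)

theorem exists_forall_norm_le_of_isBounded_range {V : Type*} [SeminormedAddCommGroup V]
    {f : ℕ → V} (h : Bornology.IsBounded (Set.range f)) : ∃ c, ∀ k, ‖f k‖ ≤ c :=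
  let ⟨c, hc⟩ := isBounded_iff_forall_norm_le.mp h
  ⟨c, fun k => hc _ (Set.mem_range_self k)⟩

/-- A sequence bounded below that decreases by `d k` up to an error `e k → 0` has decrements tending
to zero along a subsequence. The errors need not be summable, so nothing is claimed for the
full sequence. -/
theorem exists_subseq_tendsto_zero_of_descent {F d e : ℕ → ℝ} {m : ℝ} (hF : ∀ k, m ≤ F k)
    (hd : ∀ k, 0 ≤ d k) (he : Filter.Tendsto e Filter.atTop (nhds 0))
    (h : ∀ k, F (k + 1) + d k ≤ F k + e k) :
    ∃ ψ : ℕ → ℕ, StrictMono ψ ∧ Filter.Tendsto (d ∘ ψ) Filter.atTop (nhds 0) := by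
  have key : ∀ ε > 0, ∃ᶠ k in Filter.atTop, d k < ε := by
    intro ε hε hev
    have h1 : ∀ᶠ k in Filter.atTop, F (k + 1) ≤ F k - ε / 2 := by
      filter_upwards [hev, he.eventually_lt_const (half_pos hε)] with k hk1 hk2
      linarith [h k, not_lt.mp hk1]
    -- A decrease of `ε / 2` at every late step would drive `F` below `m`.
    obtain ⟨K, hK⟩ := Filter.eventually_atTop.mp h1
    have h2 : ∀ j : ℕ, F (K + j) ≤ F K - j * (ε / 2) := by
      intro j
      induction j with
      | zero => simp
      | succ j ih =>
        have := hK (K + j) (Nat.le_add_right _ _)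
        rw [← add_assoc]
        push_cast
        linarith
    obtain ⟨j, hj⟩ := exists_nat_gt ((F K - m) / (ε / 2))
    rw [div_lt_iff₀ (half_pos hε)] at hj
    linarith [h2 j, hF (K + j)]
  obtain ⟨ψ, hψ, hlt⟩ := Filter.extraction_forall_of_frequently
    (P := fun n k => d k < 1 / ((n : ℝ) + 1)) fun n => key _ (by positivity)
  exact ⟨ψ, hψ, squeeze_zero (fun n => hd _) (fun n => (hlt n).le)
    tendsto_one_div_add_atTop_nhds_zero_nat⟩

end Sequences

namespace IsADMM
variable {n₁ n₂ n₃ : ℕ} {X : Tensor n₁ n₂ n₃} {lam μ₁ μ₂ M δ : ℝ}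
  {L H E Y Z : ℕ → Tensor n₁ n₂ n₃}

theorem Y_succ_eq (h : IsADMM X lam μ₁ μ₂ L H E Y Z) (k : ℕ) :
    Y (k + 1) = -(nuclearNorm (L (k + 1)) • (‖H (k + 1)‖ ^ 3)⁻¹ • H (k + 1)) := by
  rw [h.Y_update]
  exact H_minimizer_eq (h.H_ne_zero _) (h.H_update k)

theorem L_succ_le (h : IsADMM X lam μ₁ μ₂ L H E Y Z) (k : ℕ) (A : Tensor n₁ n₂ n₃) :
    nuclearNorm (L (k + 1)) / ‖H k‖ ≤ nuclearNorm A / ‖H k‖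
      + inner ℝ (Y k + Z k + μ₁ • (L (k + 1) - H k) + μ₂ • (L (k + 1) + E k - X))
        (A - L (k + 1)) :=
  L_minimizer_le (h.L_update k) A

theorem E_succ_le (h : IsADMM X lam μ₁ μ₂ L H E Y Z) (hlam : 0 ≤ lam) (k : ℕ)
    (A : Tensor n₁ n₂ n₃) :
    lam * l1Norm (E (k + 1)) ≤ lam * l1Norm A + inner ℝ (Z (k + 1)) (A - E (k + 1)) := by
  rw [h.Z_update]
  exact E_minimizer_le hlam (h.E_update k) A

theorem norm_Y_succ_le (h : IsADMM X lam μ₁ μ₂ L H E Y Z) (hM : ∀ k, nuclearNorm (L k) ≤ M)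
    (hδ : 0 < δ) (hH : ∀ k, δ ≤ ‖H k‖) (k : ℕ) : ‖Y (k + 1)‖ ≤ M / δ ^ 2 := by
  rw [h.Y_succ_eq, norm_neg, norm_smul, norm_norm_inv_cube_smul,
    Real.norm_of_nonneg (nuclearNorm_nonneg _), div_eq_mul_inv]
  have := hH (k + 1)
  exact mul_le_mul (hM _) (by gcongr) (by positivity) ((nuclearNorm_nonneg _).trans (hM 0))

/-- The bound comes from testing the optimality of `E (k + 1)` with `E (k + 1) - Z (k + 1)`. -/
theorem norm_Z_succ_le (h : IsADMM X lam μ₁ μ₂ L H E Y Z) (hlam : 0 ≤ lam) (k : ℕ) :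
    ‖Z (k + 1)‖ ≤ lam * Fintype.card (Fin n₁ × Fin n₂ × Fin n₃) := by
  have h1 := h.E_succ_le hlam k (E (k + 1) - Z (k + 1))
  rw [sub_sub_cancel_left, inner_neg_right, real_inner_self_eq_norm_sq, sub_eq_add_neg] at h1
  have h2 : l1Norm (-Z (k + 1)) = l1Norm (Z (k + 1)) := by
    simpa using l1Norm_smul (-1) (Z (k + 1))
  have h3 := mul_le_mul_of_nonneg_left
    ((l1Norm_add_le (E (k + 1)) (-Z (k + 1))).trans (by rw [h2])) hlam
  have h4 := mul_le_mul_of_nonneg_left (l1Norm_le (Z (k + 1))) hlam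
  rcases (norm_nonneg (Z (k + 1))).eq_or_lt with h0 | h0
  · rw [← h0]
    positivity
  · refine le_of_mul_le_mul_right ?_ h0
    linarith

theorem L_sub_H_eq (h : IsADMM X lam μ₁ μ₂ L H E Y Z) (hμ₁ : 0 < μ₁) (k : ℕ) :
    L (k + 1) - H (k + 1) = μ₁⁻¹ • (Y (k + 1) - Y k) := by
  rw [h.Y_update, add_sub_cancel_left, smul_smul, inv_mul_cancel₀ hμ₁.ne', one_smul]

theorem L_add_E_sub_eq (h : IsADMM X lam μ₁ μ₂ L H E Y Z) (hμ₂ : 0 < μ₂) (k : ℕ) :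
    L (k + 1) + E (k + 1) - X = μ₂⁻¹ • (Z (k + 1) - Z k) := by
  rw [h.Z_update, add_sub_cancel_left, smul_smul, inv_mul_cancel₀ hμ₂.ne', one_smul]

theorem isBounded_Y (h : IsADMM X lam μ₁ μ₂ L H E Y Z) (hM : ∀ k, nuclearNorm (L k) ≤ M)
    (hδ : 0 < δ) (hH : ∀ k, δ ≤ ‖H k‖) : Bornology.IsBounded (Set.range Y) :=
  isBounded_range_of_norm_succ_le (h.norm_Y_succ_le hM hδ hH)

theorem isBounded_Z (h : IsADMM X lam μ₁ μ₂ L H E Y Z) (hlam : 0 ≤ lam) :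
    Bornology.IsBounded (Set.range Z) :=
  isBounded_range_of_norm_succ_le (h.norm_Z_succ_le hlam)

theorem isBounded_H (h : IsADMM X lam μ₁ μ₂ L H E Y Z) (hμ₁ : 0 < μ₁)
    (hL : Bornology.IsBounded (Set.range L)) (hY : Bornology.IsBounded (Set.range Y)) :
    Bornology.IsBounded (Set.range H) := by
  obtain ⟨a, ha⟩ := exists_forall_norm_le_of_isBounded_range hL
  obtain ⟨b, hb⟩ := exists_forall_norm_le_of_isBounded_range hY
  refine isBounded_range_of_norm_succ_le (c := a + μ₁⁻¹ * (b + b)) fun k => ?_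
  have h1 : H (k + 1) = L (k + 1) - μ₁⁻¹ • (Y (k + 1) - Y k) := by
    rw [← h.L_sub_H_eq hμ₁, sub_sub_cancel]
  rw [h1]
  refine (norm_sub_le _ _).trans (add_le_add (ha _) ?_)
  rw [norm_smul, Real.norm_of_nonneg (by positivity)]
  gcongr
  exact (norm_sub_le _ _).trans (add_le_add (hb _) (hb _))

theorem isBounded_E (h : IsADMM X lam μ₁ μ₂ L H E Y Z) (hμ₂ : 0 < μ₂)
    (hL : Bornology.IsBounded (Set.range L)) (hZ : Bornology.IsBounded (Set.range Z)) :
    Bornology.IsBounded (Set.range E) := by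
  obtain ⟨a, ha⟩ := exists_forall_norm_le_of_isBounded_range hL
  obtain ⟨b, hb⟩ := exists_forall_norm_le_of_isBounded_range hZ
  refine isBounded_range_of_norm_succ_le (c := ‖X‖ + a + μ₂⁻¹ * (b + b)) fun k => ?_
  have h1 : E (k + 1) = X - L (k + 1) + μ₂⁻¹ • (Z (k + 1) - Z k) := by
    rw [← h.L_add_E_sub_eq hμ₂]
    abel
  rw [h1]
  refine (norm_add_le _ _).trans (add_le_add
    ((norm_sub_le _ _).trans (add_le_add le_rfl (ha _))) ?_)
  rw [norm_smul, Real.norm_of_nonneg (by positivity)]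
  gcongr
  exact (norm_sub_le _ _).trans (add_le_add (hb _) (hb _))

/-- The change of the multiplier `Y` is controlled by the changes of `L` and `H`, through the formula
`Y = -‖L‖_* H / ‖H‖³`. The formula is available only after the first iteration, hence the shift of
the index. -/
theorem norm_Y_sub_sq_le (h : IsADMM X lam μ₁ μ₂ L H E Y Z) (hM : ∀ k, nuclearNorm (L k) ≤ M)
    (hδ : 0 < δ) (hH : ∀ k, δ ≤ ‖H k‖) (k : ℕ) :
    ‖Y (k + 2) - Y (k + 1)‖ ^ 2 ≤
      2 * (min n₁ n₂ : ℕ) / δ ^ 4 * ‖L (k + 2) - L (k + 1)‖ ^ 2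
        + 8 * M ^ 2 / δ ^ 6 * ‖H (k + 2) - H (k + 1)‖ ^ 2 := by
  set G : ℕ → Tensor n₁ n₂ n₃ := fun k => (‖H k‖ ^ 3)⁻¹ • H k with hG
  have h1 : Y (k + 2) - Y (k + 1) =
      -((nuclearNorm (L (k + 2)) - nuclearNorm (L (k + 1))) • G (k + 2)
        + nuclearNorm (L (k + 1)) • (G (k + 2) - G (k + 1))) := by
    rw [h.Y_succ_eq (k + 1), h.Y_succ_eq k]
    simp only [hG]
    module
  have h2 : ‖G (k + 2)‖ ≤ 1 / δ ^ 2 := by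
    simp only [hG, norm_norm_inv_cube_smul, one_div]
    have := hH (k + 2)
    gcongr
  have h3 : ‖G (k + 2) - G (k + 1)‖ ≤ 2 / δ ^ 3 * ‖H (k + 2) - H (k + 1)‖ :=
    norm_smul_inv_cube_sub_le hδ (hH _) (hH _)
  have h4 : ‖Y (k + 2) - Y (k + 1)‖ ≤
      √(min n₁ n₂ : ℕ) * ‖L (k + 2) - L (k + 1)‖ * (1 / δ ^ 2)
        + M * (2 / δ ^ 3 * ‖H (k + 2) - H (k + 1)‖) := by
    rw [h1, norm_neg]
    refine (norm_add_le _ _).trans ?_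
    rw [norm_smul _ (G (k + 2)), norm_smul _ (G (k + 2) - G (k + 1)),
      Real.norm_of_nonneg (nuclearNorm_nonneg _), Real.norm_eq_abs]
    refine add_le_add (mul_le_mul (abs_nuclearNorm_sub_le _ _) h2 (norm_nonneg _) (by positivity))
      (mul_le_mul (hM _) h3 (norm_nonneg _) ((nuclearNorm_nonneg _).trans (hM 0)))
  refine (pow_le_pow_left₀ (norm_nonneg _) h4 2).trans ((add_sq_le).trans (le_of_eq ?_))
  rw [mul_pow, mul_pow, Real.sq_sqrt (by positivity)]
  ring

/-- Descent of the Lagrangian over one full iteration. The ascent of the `Y`-update is absorbed by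
the decrease in `L` and `H`; the ascent of the `Z`-update remains on the right. -/
theorem augLagrangian_descent (h : IsADMM X lam μ₁ μ₂ L H E Y Z) (hμ₁ : 0 < μ₁) (hμ₂ : 0 < μ₂)
    (hM : ∀ k, nuclearNorm (L k) ≤ M) (hδ : 0 < δ) (hH : ∀ k, δ ≤ ‖H k‖) (k : ℕ) :
    augLagrangian X lam μ₁ μ₂ (L (k + 2)) (H (k + 2)) (E (k + 2)) (Y (k + 2)) (Z (k + 2))
      + (((μ₁ + μ₂) / 2 - 2 * (min n₁ n₂ : ℕ) / (μ₁ * δ ^ 4)) * ‖L (k + 2) - L (k + 1)‖ ^ 2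
      + (μ₁ / 2 - M / (2 * δ ^ 3) - 8 * M ^ 2 / (μ₁ * δ ^ 6)) * ‖H (k + 2) - H (k + 1)‖ ^ 2) ≤
    augLagrangian X lam μ₁ μ₂ (L (k + 1)) (H (k + 1)) (E (k + 1)) (Y (k + 1)) (Z (k + 1))
      + μ₂⁻¹ * ‖Z (k + 2) - Z (k + 1)‖ ^ 2 := by
  have hL := L_minimizer_decrease (h.L_update (k + 1)) (L (k + 1))
  have hHd := H_minimizer_decrease (h.H_ne_zero (k + 2)) (h.H_update (k + 1))
    (h.H_ne_zero (k + 1))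
  have hE := h.E_update (k + 1) (E (k + 1))
  have hYZ := augLagrangian_eq_of_YZ (X := X) (L := L (k + 2)) (H := H (k + 2)) (E := E (k + 2))
    (Y := Y (k + 1)) (Z := Z (k + 1)) (lam := lam) (μ₁ := μ₁) (μ₂ := μ₂) (Y (k + 2)) (Z (k + 2))
  rw [h.L_sub_H_eq hμ₁ (k + 1), h.L_add_E_sub_eq hμ₂ (k + 1), real_inner_smul_right,
    real_inner_smul_right, real_inner_self_eq_norm_sq, real_inner_self_eq_norm_sq] at hYZ
  rw [norm_sub_rev] at hL hHd
  have hY := mul_le_mul_of_nonneg_left (h.norm_Y_sub_sq_le hM hδ hH k) (inv_nonneg.mpr hμ₁.le)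
  have hfrac : nuclearNorm (L (k + 2)) / (2 * ‖H (k + 2)‖ ^ 3) ≤ M / (2 * δ ^ 3) := by
    have h1 := hH (k + 2)
    have h2 := (nuclearNorm_nonneg _).trans (hM 0)
    exact div_le_div₀ h2 (hM _) (by positivity) (by gcongr)
  have hfrac' := mul_le_mul_of_nonneg_right hfrac (sq_nonneg ‖H (k + 2) - H (k + 1)‖)
  have e1 : μ₁⁻¹ * (2 * (min n₁ n₂ : ℕ) / δ ^ 4 * ‖L (k + 2) - L (k + 1)‖ ^ 2
      + 8 * M ^ 2 / δ ^ 6 * ‖H (k + 2) - H (k + 1)‖ ^ 2) =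
      2 * (min n₁ n₂ : ℕ) / (μ₁ * δ ^ 4) * ‖L (k + 2) - L (k + 1)‖ ^ 2
      + 8 * M ^ 2 / (μ₁ * δ ^ 6) * ‖H (k + 2) - H (k + 1)‖ ^ 2 := by
    field_simp
  rw [e1] at hY
  simp only [add_assoc, one_add_one_eq_two] at hL hHd hE hYZ ⊢
  linarith

theorem exists_le_augLagrangian (hlam : 0 ≤ lam) (hμ₁ : 0 < μ₁) (hμ₂ : 0 < μ₂)
    (hL : Bornology.IsBounded (Set.range L)) (hH : Bornology.IsBounded (Set.range H))
    (hE : Bornology.IsBounded (Set.range E)) (hY : Bornology.IsBounded (Set.range Y))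
    (hZ : Bornology.IsBounded (Set.range Z)) :
    ∃ m, ∀ k, m ≤ augLagrangian X lam μ₁ μ₂ (L k) (H k) (E k) (Y k) (Z k) := by
  obtain ⟨a, ha⟩ := exists_forall_norm_le_of_isBounded_range hL
  obtain ⟨b, hb⟩ := exists_forall_norm_le_of_isBounded_range hH
  obtain ⟨c, hc⟩ := exists_forall_norm_le_of_isBounded_range hE
  obtain ⟨p, hp⟩ := exists_forall_norm_le_of_isBounded_range hY
  obtain ⟨q, hq⟩ := exists_forall_norm_le_of_isBounded_range hZ
  refine ⟨-(p * (a + b)) - q * (a + c + ‖X‖), fun k => ?_⟩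
  have h1 : -(p * (a + b)) ≤ inner ℝ (Y k) (L k - H k) := by
    have h2 : ‖Y k‖ * ‖L k - H k‖ ≤ p * (a + b) :=
      mul_le_mul (hp k) ((norm_sub_le _ _).trans (add_le_add (ha k) (hb k))) (norm_nonneg _)
        ((norm_nonneg _).trans (hp k))
    linarith [neg_le_of_abs_le (abs_real_inner_le_norm (Y k) (L k - H k))]
  have h3 : -(q * (a + c + ‖X‖)) ≤ inner ℝ (Z k) (L k + E k - X) := by
    have h2 : ‖Z k‖ * ‖L k + E k - X‖ ≤ q * (a + c + ‖X‖) :=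
      mul_le_mul (hq k) ((norm_sub_le _ _).trans (add_le_add
        ((norm_add_le _ _).trans (add_le_add (ha k) (hc k))) le_rfl)) (norm_nonneg _)
        ((norm_nonneg _).trans (hq k))
    linarith [neg_le_of_abs_le (abs_real_inner_le_norm (Z k) (L k + E k - X))]
  have h4 : 0 ≤ nuclearNorm (L k) / ‖H k‖ := div_nonneg (nuclearNorm_nonneg _) (norm_nonneg _)
  have h5 : 0 ≤ lam * l1Norm (E k) := mul_nonneg hlam (l1Norm_nonneg _)
  have h6 : 0 ≤ μ₁ / 2 * ‖L k - H k‖ ^ 2 := by positivity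
  have h7 : 0 ≤ μ₂ / 2 * ‖L k + E k - X‖ ^ 2 := by positivity
  unfold augLagrangian
  linarith

end IsADMM

/-! ### Stationarity and convergence of a subsequence -/

open Filter Topology

section Criticality
variable {n₁ n₂ n₃ : ℕ} {X L H E Y Z : Tensor n₁ n₂ n₃} {lam μ₁ μ₂ : ℝ}

theorem abs_inv_norm_sub_le {V : Type*} [NormedAddCommGroup V] {x y : V} (hx : x ≠ 0)
    (hy : ‖x‖ / 2 ≤ ‖y‖) : |1 / ‖y‖ - 1 / ‖x‖| ≤ 2 / ‖x‖ ^ 2 * ‖y - x‖ := by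
  have ha := norm_pos_iff.mpr hx
  have hb : 0 < ‖y‖ := (half_pos ha).trans_le hy
  have h1 : 1 / ‖y‖ - 1 / ‖x‖ = (‖x‖ - ‖y‖) / (‖y‖ * ‖x‖) := by field_simp
  have h2 : 1 / (‖y‖ * ‖x‖) ≤ 2 / ‖x‖ ^ 2 := by
    rw [div_le_div_iff₀ (by positivity) (by positivity)]
    nlinarith
  rw [h1, abs_div, abs_of_pos (mul_pos hb ha), div_eq_mul_one_div, mul_comm]
  refine mul_le_mul h2 ?_ (abs_nonneg _) (by positivity)
  rw [norm_sub_rev]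
  exact abs_norm_sub_norm_le x y

/-- Near a point that satisfies the stationarity conditions block by block, the Lagrangian falls
below its value there by at most products of two distances: `inv_norm_ge` handles the coupling
`‖L‖_* / ‖H‖` in `H`, and the bilinear terms in the multipliers are of second order since
`L = H` and `L + E = X` at the point. -/
theorem augLagrangian_sub_le_of_stationary (hμ₁ : 0 ≤ μ₁) (hμ₂ : 0 ≤ μ₂) (hH : H ≠ 0)
    (hLH : L = H) (hLE : L + E = X) (hY : Y = -(nuclearNorm L • (‖H‖ ^ 3)⁻¹ • H))
    (hL : ∀ A, nuclearNorm L / ‖H‖ ≤ nuclearNorm A / ‖H‖ + inner ℝ (Y + Z) (A - L))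
    (hE : ∀ A, lam * l1Norm E ≤ lam * l1Norm A + inner ℝ Z (A - E))
    {A B D P Q : Tensor n₁ n₂ n₃} (hB : ‖H‖ / 2 ≤ ‖B‖) :
    augLagrangian X lam μ₁ μ₂ L H E Y Z
      - (nuclearNorm L / (2 * ‖H‖ ^ 3) * ‖B - H‖ ^ 2
        + √(min n₁ n₂ : ℕ) * ‖A - L‖ * (2 / ‖H‖ ^ 2 * ‖B - H‖)
        + ‖P - Y‖ * (‖A - L‖ + ‖B - H‖) + ‖Q - Z‖ * (‖A - L‖ + ‖D - E‖)) ≤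
      augLagrangian X lam μ₁ μ₂ A B D P Q := by
  have ha := norm_pos_iff.mpr hH
  have hB0 : B ≠ 0 := norm_pos_iff.mp ((half_pos ha).trans_le hB)
  have e0 : augLagrangian X lam μ₁ μ₂ L H E Y Z = nuclearNorm L / ‖H‖ + lam * l1Norm E := by
    simp [augLagrangian, hLE, ← hLH]
  have e1 : A - B = (A - L) - (B - H) := by rw [hLH]; abel
  have e2 : A + D - X = (A - L) + (D - E) := by rw [← hLE]; abel
  have i1 : -(‖P - Y‖ * (‖A - L‖ + ‖B - H‖)) ≤ inner ℝ (P - Y) (A - B) := by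
    refine neg_le_of_abs_le ((abs_real_inner_le_norm _ _).trans ?_)
    rw [e1]
    gcongr
    exact norm_sub_le _ _
  have i2 : -(‖Q - Z‖ * (‖A - L‖ + ‖D - E‖)) ≤ inner ℝ (Q - Z) (A + D - X) := by
    refine neg_le_of_abs_le ((abs_real_inner_le_norm _ _).trans ?_)
    rw [e2]
    gcongr
    exact norm_add_le _ _
  have i3 : -(√(min n₁ n₂ : ℕ) * ‖A - L‖ * (2 / ‖H‖ ^ 2 * ‖B - H‖)) ≤
      (nuclearNorm A - nuclearNorm L) * (1 / ‖B‖ - 1 / ‖H‖) := by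
    refine neg_le_of_abs_le ?_
    rw [abs_mul]
    exact mul_le_mul (abs_nuclearNorm_sub_le _ _) (abs_inv_norm_sub_le hH hB) (abs_nonneg _)
      (by positivity)
  have i4 := mul_le_mul_of_nonneg_left (inv_norm_ge hH hB0) (nuclearNorm_nonneg L)
  have e4 : nuclearNorm L * (1 / ‖H‖ - inner ℝ H (B - H) / ‖H‖ ^ 3
      - ‖B - H‖ ^ 2 / (2 * ‖H‖ ^ 3)) = nuclearNorm L * (1 / ‖H‖) + inner ℝ Y (B - H)
      - nuclearNorm L / (2 * ‖H‖ ^ 3) * ‖B - H‖ ^ 2 := by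
    rw [hY, inner_neg_left, real_inner_smul_left, real_inner_smul_left]
    ring
  rw [e4] at i4
  have i5 := hL A
  have i6 := hE D
  have e5 : nuclearNorm A / ‖B‖ = nuclearNorm A / ‖H‖ + nuclearNorm L * (1 / ‖B‖)
      - nuclearNorm L * (1 / ‖H‖) + (nuclearNorm A - nuclearNorm L) * (1 / ‖B‖ - 1 / ‖H‖) := by
    ring
  have e6 : inner ℝ P (A - B) =
      inner ℝ Y (A - L) - inner ℝ Y (B - H) + inner ℝ (P - Y) (A - B) := by
    rw [inner_sub_left, ← inner_sub_right, ← e1]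
    ring
  have e7 : inner ℝ Q (A + D - X) =
      inner ℝ Z (A - L) + inner ℝ Z (D - E) + inner ℝ (Q - Z) (A + D - X) := by
    rw [inner_sub_left, ← inner_add_right, ← e2]
    ring
  have i7 : 0 ≤ μ₁ / 2 * ‖A - B‖ ^ 2 := by positivity
  have i8 : 0 ≤ μ₂ / 2 * ‖A + D - X‖ ^ 2 := by positivity
  rw [inner_add_left] at i5
  rw [e0]
  unfold augLagrangian
  rw [e5, e6, e7]
  linarith

/-- Blockwise stationarity gives joint stationarity, already for the regular subdifferential. -/
theorem zero_mem_regularSubdifferential_of_stationary {C : State n₁ n₂ n₃} (hμ₁ : 0 ≤ μ₁)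
    (hμ₂ : 0 ≤ μ₂) (hH : C 1 ≠ 0) (hLH : C 0 = C 1) (hLE : C 0 + C 2 = X)
    (hY : C 3 = -(nuclearNorm (C 0) • (‖C 1‖ ^ 3)⁻¹ • C 1))
    (hL : ∀ A, nuclearNorm (C 0) / ‖C 1‖ ≤
      nuclearNorm A / ‖C 1‖ + inner ℝ (C 3 + C 4) (A - C 0))
    (hE : ∀ A, lam * l1Norm (C 2) ≤ lam * l1Norm A + inner ℝ (C 4) (A - C 2)) :
    0 ∈ regularSubdifferential (stateLagrangian X lam μ₁ μ₂) C := by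
  intro ε hε
  have ha := norm_pos_iff.mpr hH
  set K : ℝ := nuclearNorm (C 0) / (2 * ‖C 1‖ ^ 3) + √(min n₁ n₂ : ℕ) * (2 / ‖C 1‖ ^ 2) + 4
    with hK
  have hK0 : 0 < K := by
    have := nuclearNorm_nonneg (C 0)
    positivity
  filter_upwards [Metric.ball_mem_nhds C (div_pos hε hK0),
    Metric.ball_mem_nhds C (half_pos ha)] with y hy1 hy2
  rw [mem_ball_iff_norm] at hy1 hy2
  have hj : ∀ j, ‖y j - C j‖ ≤ ‖y - C‖ := fun j => PiLp.norm_apply_le (y - C) j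
  have hB : ‖C 1‖ / 2 ≤ ‖y 1‖ := by
    have h1 := norm_sub_norm_le (C 1) (y 1)
    rw [norm_sub_rev] at h1
    linarith [hj 1]
  have h := augLagrangian_sub_le_of_stationary hμ₁ hμ₂ hH hLH hLE hY hL hE
    (A := y 0) (D := y 2) (P := y 3) (Q := y 4) hB
  have herr : nuclearNorm (C 0) / (2 * ‖C 1‖ ^ 3) * ‖y 1 - C 1‖ ^ 2
        + √(min n₁ n₂ : ℕ) * ‖y 0 - C 0‖ * (2 / ‖C 1‖ ^ 2 * ‖y 1 - C 1‖)
        + ‖y 3 - C 3‖ * (‖y 0 - C 0‖ + ‖y 1 - C 1‖)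
        + ‖y 4 - C 4‖ * (‖y 0 - C 0‖ + ‖y 2 - C 2‖) ≤ K * ‖y - C‖ * ‖y - C‖ := by
    have hN := nuclearNorm_nonneg (C 0)
    calc _ ≤ nuclearNorm (C 0) / (2 * ‖C 1‖ ^ 3) * ‖y - C‖ ^ 2
        + √(min n₁ n₂ : ℕ) * ‖y - C‖ * (2 / ‖C 1‖ ^ 2 * ‖y - C‖)
        + ‖y - C‖ * (‖y - C‖ + ‖y - C‖) + ‖y - C‖ * (‖y - C‖ + ‖y - C‖) := by
          gcongr <;> exact hj _
      _ = _ := by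
          rw [hK]
          ring
  have hsmall : K * ‖y - C‖ * ‖y - C‖ ≤ ε * ‖y - C‖ := by
    refine mul_le_mul_of_nonneg_right ?_ (norm_nonneg _)
    rw [lt_div_iff₀ hK0] at hy1
    linarith
  rw [inner_zero_left, add_zero]
  unfold stateLagrangian
  linarith

theorem regularSubdifferential_subset_limitingSubdifferential {V : Type*} [NormedAddCommGroup V]
    [InnerProductSpace ℝ V] (f : V → ℝ) (x : V) :
    regularSubdifferential f x ⊆ limitingSubdifferential f x := fun v hv =>
  ⟨fun _ => x, fun _ => v, tendsto_const_nhds, tendsto_const_nhds, fun _ => hv, tendsto_const_nhds⟩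

end Criticality

theorem tendsto_zero_of_norm_sq_le {V : Type*} [NormedAddCommGroup V] {f : ℕ → V} {g : ℕ → ℝ}
    (h : ∀ i, ‖f i‖ ^ 2 ≤ g i) (hg : Tendsto g atTop (𝓝 0)) : Tendsto f atTop (𝓝 0) := by
  have h1 : Tendsto (fun i => ‖f i‖ ^ 2) atTop (𝓝 0) := squeeze_zero (fun _ => sq_nonneg _) h hg
  have h2 := (Real.continuous_sqrt.tendsto 0).comp h1
  rw [Real.sqrt_zero] at h2
  refine tendsto_zero_iff_norm_tendsto_zero.mpr (h2.congr fun i => ?_)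
  exact Real.sqrt_sq (norm_nonneg _)

/-- The assumed lower bound on `μ₁` suffices for the descent: the sharp tangent bound replaces
`3M/δ³` by `M/(2δ³)`, and the difference pays for the doubled last term. -/
theorem quadratic_coefficient_pos {μ δ M : ℝ} (hμ : 0 < μ) (hδ : 0 < δ) (hM : 0 ≤ M)
    (h : 0 < μ / 2 - 3 * M / δ ^ 3 - 4 * M ^ 2 / (μ * δ ^ 6)) :
    0 < μ / 2 - M / (2 * δ ^ 3) - 8 * M ^ 2 / (μ * δ ^ 6) := by
  set s := M / δ ^ 3 with hs
  have hs0 : 0 ≤ s := by positivity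
  have e1 : 3 * M / δ ^ 3 = 3 * s := by rw [hs]; ring
  have e2 : 4 * M ^ 2 / (μ * δ ^ 6) = 4 * (s ^ 2 / μ) := by rw [hs]; field_simp
  have e3 : M / (2 * δ ^ 3) = s / 2 := by rw [hs]; field_simp
  have e4 : 8 * M ^ 2 / (μ * δ ^ 6) = 8 * (s ^ 2 / μ) := by rw [hs]; field_simp
  rw [e1, e2] at h
  rw [e3, e4]
  have h1 : 0 ≤ s ^ 2 / μ := by positivity
  -- The hypothesis forces `6 * s < μ`.
  have h2 : s ^ 2 / μ ≤ s / 6 := by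
    rw [div_le_iff₀ hμ]
    nlinarith
  linarith

namespace IsADMM
variable {n₁ n₂ n₃ : ℕ} {X : Tensor n₁ n₂ n₃} {lam μ₁ μ₂ M δ : ℝ}
  {L H E Y Z : ℕ → Tensor n₁ n₂ n₃}

/-- Along a suitable subsequence the successive differences of all variables but the first tend to
zero; this is the subsequence from which the critical point is extracted. -/
theorem exists_subseq_sub_tendsto_zero (h : IsADMM X lam μ₁ μ₂ L H E Y Z) (hμ₁ : 0 < μ₁)
    (hμ₂ : 0 < μ₂) (hM : ∀ k, nuclearNorm (L k) ≤ M) (hδ : 0 < δ) (hH : ∀ k, δ ≤ ‖H k‖)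
    {m : ℝ} (hm : ∀ k, m ≤ augLagrangian X lam μ₁ μ₂ (L k) (H k) (E k) (Y k) (Z k))
    (h1 : 0 < (μ₁ + μ₂) / 2 - 2 * (min n₁ n₂ : ℕ) / (μ₁ * δ ^ 4))
    (h2 : 0 < μ₁ / 2 - 3 * M / δ ^ 3 - 4 * M ^ 2 / (μ₁ * δ ^ 6))
    (hZ : Tendsto (fun k => ‖Z (k + 1) - Z k‖) atTop (𝓝 0)) :
    ∃ χ : ℕ → ℕ, StrictMono χ ∧
      Tendsto (fun i => H (χ i + 1) - H (χ i)) atTop (𝓝 0) ∧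
      Tendsto (fun i => E (χ i + 1) - E (χ i)) atTop (𝓝 0) ∧
      Tendsto (fun i => Y (χ i + 1) - Y (χ i)) atTop (𝓝 0) := by
  have h3 := quadratic_coefficient_pos hμ₁ hδ ((nuclearNorm_nonneg _).trans (hM 0)) h2
  set a := (μ₁ + μ₂) / 2 - 2 * (min n₁ n₂ : ℕ) / (μ₁ * δ ^ 4) with ha
  set b := μ₁ / 2 - M / (2 * δ ^ 3) - 8 * M ^ 2 / (μ₁ * δ ^ 6) with hb
  have hZ0 : Tendsto (fun k => Z (k + 1) - Z k) atTop (𝓝 0) :=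
    tendsto_zero_iff_norm_tendsto_zero.mpr hZ
  have hZ1 : Tendsto (fun k => Z (k + 2) - Z (k + 1)) atTop (𝓝 0) :=
    hZ0.comp (tendsto_add_atTop_nat 1)
  have he : Tendsto (fun k => μ₂⁻¹ * ‖Z (k + 2) - Z (k + 1)‖ ^ 2) atTop (𝓝 0) := by
    simpa using (hZ1.norm.pow 2).const_mul μ₂⁻¹
  obtain ⟨ψ, hψ, hd⟩ := exists_subseq_tendsto_zero_of_descent
    (F := fun k => augLagrangian X lam μ₁ μ₂ (L (k + 1)) (H (k + 1)) (E (k + 1)) (Y (k + 1))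
      (Z (k + 1)))
    (d := fun k => a * ‖L (k + 2) - L (k + 1)‖ ^ 2 + b * ‖H (k + 2) - H (k + 1)‖ ^ 2)
    (fun k => hm _) (fun k => by positivity) he
    (fun k => h.augLagrangian_descent hμ₁ hμ₂ hM hδ hH k)
  have hL : Tendsto (fun i => L (ψ i + 2) - L (ψ i + 1)) atTop (𝓝 0) := by
    refine tendsto_zero_of_norm_sq_le (fun i => ?_) (by simpa using hd.const_mul a⁻¹)
    rw [inv_mul_eq_div, le_div_iff₀ h1]
    have : 0 ≤ b * ‖H (ψ i + 2) - H (ψ i + 1)‖ ^ 2 := by positivity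
    linarith
  have hHd : Tendsto (fun i => H (ψ i + 2) - H (ψ i + 1)) atTop (𝓝 0) := by
    refine tendsto_zero_of_norm_sq_le (fun i => ?_) (by simpa using hd.const_mul b⁻¹)
    rw [inv_mul_eq_div, le_div_iff₀ h3]
    have : 0 ≤ a * ‖L (ψ i + 2) - L (ψ i + 1)‖ ^ 2 := by positivity
    linarith
  refine ⟨fun i => ψ i + 1, hψ.add_const 1, hHd, ?_, ?_⟩
  -- `E` is determined by `L` and by the last two values of `Z`.
  · have hlim := (((hZ1.comp hψ.tendsto_atTop).const_smul μ₂⁻¹).sub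
      ((hZ0.comp hψ.tendsto_atTop).const_smul μ₂⁻¹)).sub hL
    simp only [smul_zero, sub_zero] at hlim
    refine hlim.congr fun i => ?_
    simp only [Function.comp_apply]
    rw [← h.L_add_E_sub_eq hμ₂ (ψ i), ← h.L_add_E_sub_eq hμ₂ (ψ i + 1)]
    simp only [add_assoc, one_add_one_eq_two]
    abel
  · refine tendsto_zero_of_norm_sq_le (fun i => h.norm_Y_sub_sq_le hM hδ hH (ψ i)) ?_
    simpa using ((hL.norm.pow 2).const_mul (2 * (min n₁ n₂ : ℕ) / δ ^ 4)).add
      ((hHd.norm.pow 2).const_mul (8 * M ^ 2 / δ ^ 6))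

/-- If the successive differences vanish along the chosen indices, the optimality conditions of the
three subproblems pass to the limit and become the joint stationarity conditions. -/
theorem isCriticalPoint_of_tendsto (h : IsADMM X lam μ₁ μ₂ L H E Y Z) (hlam : 0 ≤ lam)
    (hμ₁ : 0 < μ₁) (hμ₂ : 0 < μ₂) (hδ : 0 < δ) (hH : ∀ k, δ ≤ ‖H k‖) {χ : ℕ → ℕ}
    (hH0 : Tendsto (fun i => H (χ i + 1) - H (χ i)) atTop (𝓝 0))
    (hE0 : Tendsto (fun i => E (χ i + 1) - E (χ i)) atTop (𝓝 0))
    (hY0 : Tendsto (fun i => Y (χ i + 1) - Y (χ i)) atTop (𝓝 0))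
    (hZ0 : Tendsto (fun i => Z (χ i + 1) - Z (χ i)) atTop (𝓝 0))
    {C : State n₁ n₂ n₃}
    (hC : Tendsto (fun i => mkState (L (χ i + 1)) (H (χ i + 1)) (E (χ i + 1)) (Y (χ i + 1))
      (Z (χ i + 1))) atTop (𝓝 C)) :
    IsCriticalPoint X lam μ₁ μ₂ C := by
  have hcoord : ∀ j : Fin 5, Tendsto (fun i => mkState (L (χ i + 1)) (H (χ i + 1)) (E (χ i + 1))
      (Y (χ i + 1)) (Z (χ i + 1)) j) atTop (𝓝 (C j)) := fun j =>
    ((PiLp.continuous_apply 2 _ j).tendsto C).comp hC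
  have hL1 : Tendsto (fun i => L (χ i + 1)) atTop (𝓝 (C 0)) := hcoord 0
  have hH1 : Tendsto (fun i => H (χ i + 1)) atTop (𝓝 (C 1)) := hcoord 1
  have hE1 : Tendsto (fun i => E (χ i + 1)) atTop (𝓝 (C 2)) := hcoord 2
  have hY1 : Tendsto (fun i => Y (χ i + 1)) atTop (𝓝 (C 3)) := hcoord 3
  have hZ1 : Tendsto (fun i => Z (χ i + 1)) atTop (𝓝 (C 4)) := hcoord 4
  have hH2 : Tendsto (fun i => H (χ i)) atTop (𝓝 (C 1)) := by
    simpa using hH1.sub hH0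
  have hE2 : Tendsto (fun i => E (χ i)) atTop (𝓝 (C 2)) := by
    simpa using hE1.sub hE0
  have hY2 : Tendsto (fun i => Y (χ i)) atTop (𝓝 (C 3)) := by
    simpa using hY1.sub hY0
  have hZ2 : Tendsto (fun i => Z (χ i)) atTop (𝓝 (C 4)) := by
    simpa using hZ1.sub hZ0
  have hCH : δ ≤ ‖C 1‖ := ge_of_tendsto' hH1.norm fun i => hH _
  have hCH0 : C 1 ≠ 0 := norm_pos_iff.mp (hδ.trans_le hCH)
  have hLH : C 0 = C 1 := by
    refine sub_eq_zero.mp (tendsto_nhds_unique (hL1.sub hH1) ?_)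
    simp only [h.L_sub_H_eq hμ₁]
    simpa using hY0.const_smul μ₁⁻¹
  have hLE : C 0 + C 2 = X := by
    refine sub_eq_zero.mp (tendsto_nhds_unique ((hL1.add hE1).sub_const X) ?_)
    simp only [h.L_add_E_sub_eq hμ₂]
    simpa using hZ0.const_smul μ₂⁻¹
  have hN1 : Tendsto (fun i => nuclearNorm (L (χ i + 1))) atTop (𝓝 (nuclearNorm (C 0))) :=
    (continuous_nuclearNorm.tendsto _).comp hL1
  have hY : C 3 = -(nuclearNorm (C 0) • (‖C 1‖ ^ 3)⁻¹ • C 1) := by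
    refine tendsto_nhds_unique hY1 ?_
    simp only [h.Y_succ_eq]
    exact (hN1.smul (((hH1.norm.pow 3).inv₀ (by positivity)).smul hH1)).neg
  refine ⟨hCH0, regularSubdifferential_subset_limitingSubdifferential _ _
    (zero_mem_regularSubdifferential_of_stationary hμ₁.le hμ₂.le hCH0 hLH hLE hY ?_ ?_)⟩
  · intro A
    have hw : Tendsto (fun i => Y (χ i) + Z (χ i) + μ₁ • (L (χ i + 1) - H (χ i))
        + μ₂ • (L (χ i + 1) + E (χ i) - X)) atTop (𝓝 (C 3 + C 4)) := by
      have := ((hY2.add hZ2).add ((hL1.sub hH2).const_smul μ₁)).add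
        (((hL1.add hE2).sub_const X).const_smul μ₂)
      simpa [hLE, ← hLH] using this
    exact le_of_tendsto_of_tendsto' (hN1.div hH2.norm (norm_ne_zero_iff.mpr hCH0))
      ((tendsto_const_nhds.div hH2.norm (norm_ne_zero_iff.mpr hCH0)).add
        (hw.inner (tendsto_const_nhds.sub hL1))) fun i => h.L_succ_le (χ i) A
  · intro A
    exact le_of_tendsto_of_tendsto' (((continuous_l1Norm.tendsto _).comp hE1).const_mul lam)
      ((hZ1.inner (tendsto_const_nhds.sub hE1)).const_add (lam * l1Norm A))
      fun i => h.E_succ_le hlam (χ i) A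

end IsADMM

theorem exists_subseq_mkState_tendsto {n₁ n₂ n₃ : ℕ} {L H E Y Z : ℕ → Tensor n₁ n₂ n₃}
    (hL : Bornology.IsBounded (Set.range L)) (hH : Bornology.IsBounded (Set.range H))
    (hE : Bornology.IsBounded (Set.range E)) (hY : Bornology.IsBounded (Set.range Y))
    (hZ : Bornology.IsBounded (Set.range Z)) (χ : ℕ → ℕ) :
    ∃ (C : State n₁ n₂ n₃) (θ : ℕ → ℕ), StrictMono θ ∧
      Tendsto (fun i => mkState (L (χ (θ i))) (H (χ (θ i))) (E (χ (θ i))) (Y (χ (θ i)))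
        (Z (χ (θ i)))) atTop (𝓝 C) := by
  obtain ⟨a, ha⟩ := exists_forall_norm_le_of_isBounded_range hL
  obtain ⟨b, hb⟩ := exists_forall_norm_le_of_isBounded_range hH
  obtain ⟨c, hc⟩ := exists_forall_norm_le_of_isBounded_range hE
  obtain ⟨p, hp⟩ := exists_forall_norm_le_of_isBounded_range hY
  obtain ⟨q, hq⟩ := exists_forall_norm_le_of_isBounded_range hZ
  have hbd : Bornology.IsBounded (Set.range fun k =>
      mkState (L (χ k)) (H (χ k)) (E (χ k)) (Y (χ k)) (Z (χ k))) := by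
    refine isBounded_iff_forall_norm_le.mpr
      ⟨√(a ^ 2 + b ^ 2 + c ^ 2 + p ^ 2 + q ^ 2), ?_⟩
    rintro _ ⟨k, rfl⟩
    rw [PiLp.norm_eq_of_L2]
    refine Real.sqrt_le_sqrt ?_
    simp only [mkState, Fin.sum_univ_five]
    have := pow_le_pow_left₀ (norm_nonneg _) (ha (χ k)) 2
    have := pow_le_pow_left₀ (norm_nonneg _) (hb (χ k)) 2
    have := pow_le_pow_left₀ (norm_nonneg _) (hc (χ k)) 2
    have := pow_le_pow_left₀ (norm_nonneg _) (hp (χ k)) 2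
    have := pow_le_pow_left₀ (norm_nonneg _) (hq (χ k)) 2
    simp only [Matrix.cons_val]
    linarith
  obtain ⟨C, -, θ, hθ, hlim⟩ := tendsto_subseq_of_bounded hbd fun k => Set.mem_range_self k
  exact ⟨C, θ, hθ, hlim⟩

end TNF

theorem theorem2 {n₁ n₂ n₃ : ℕ} (X : TNF.Tensor n₁ n₂ n₃) (lam μ₁ μ₂ : ℝ)
    (hlam : 0 < lam) (hμ₁ : 0 < μ₁) (hμ₂ : 0 < μ₂)
    (L H E Y Z : ℕ → TNF.Tensor n₁ n₂ n₃)
    (hADMM : TNF.IsADMM X lam μ₁ μ₂ L H E Y Z)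
    (M : ℝ) (hLbdd : Bornology.IsBounded (Set.range L)) (hLM : ∀ k, TNF.nuclearNorm (L k) ≤ M)
    (δ : ℝ) (hδ : 0 < δ) (hHδ : ∀ k, δ ≤ ‖H k‖) :
    (Bornology.IsBounded (Set.range H) ∧ Bornology.IsBounded (Set.range E) ∧
      Bornology.IsBounded (Set.range Y) ∧ Bornology.IsBounded (Set.range Z)) ∧
    ∃ (φ : ℕ → ℕ) (C : TNF.State n₁ n₂ n₃), StrictMono φ ∧
      Filter.Tendsto
        (fun i => TNF.mkState (L (φ i)) (H (φ i)) (E (φ i)) (Y (φ i)) (Z (φ i)))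
        Filter.atTop (nhds C) ∧
      (0 < (μ₁ + μ₂) / 2 - 2 * (min n₁ n₂ : ℕ) / (μ₁ * δ ^ 4) →
        0 < μ₁ / 2 - 3 * M / δ ^ 3 - 4 * M ^ 2 / (μ₁ * δ ^ 6) →
        Filter.Tendsto (fun k => ‖Z (k + 1) - Z k‖) Filter.atTop (nhds 0) →
        TNF.IsCriticalPoint X lam μ₁ μ₂ C) := by
  have hY := hADMM.isBounded_Y hLM hδ hHδ
  have hZ := hADMM.isBounded_Z hlam.le
  have hH := hADMM.isBounded_H hμ₁ hLbdd hY
  have hE := hADMM.isBounded_E hμ₂ hLbdd hZ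
  refine ⟨⟨hH, hE, hY, hZ⟩, ?_⟩
  by_cases hcond : 0 < (μ₁ + μ₂) / 2 - 2 * (min n₁ n₂ : ℕ) / (μ₁ * δ ^ 4) ∧
      0 < μ₁ / 2 - 3 * M / δ ^ 3 - 4 * M ^ 2 / (μ₁ * δ ^ 6) ∧
      Filter.Tendsto (fun k => ‖Z (k + 1) - Z k‖) Filter.atTop (nhds 0)
  · obtain ⟨h1, h2, hZ0⟩ := hcond
    obtain ⟨m, hm⟩ := TNF.IsADMM.exists_le_augLagrangian (X := X) hlam.le hμ₁ hμ₂ hLbdd hH hE hY hZ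
    obtain ⟨χ, hχ, hH1, hE1, hY1⟩ :=
      hADMM.exists_subseq_sub_tendsto_zero hμ₁ hμ₂ hLM hδ hHδ hm h1 h2 hZ0
    obtain ⟨C, θ, hθ, hC⟩ :=
      TNF.exists_subseq_mkState_tendsto hLbdd hH hE hY hZ (fun i => χ i + 1)
    have hθ' := hθ.tendsto_atTop
    refine ⟨fun i => χ (θ i) + 1, C, (hχ.comp hθ).add_const 1, hC, fun _ _ _ => ?_⟩
    exact hADMM.isCriticalPoint_of_tendsto hlam.le hμ₁ hμ₂ hδ hHδ (χ := χ ∘ θ)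
      (hH1.comp hθ') (hE1.comp hθ') (hY1.comp hθ')
      ((tendsto_zero_iff_norm_tendsto_zero.mpr hZ0).comp (hχ.comp hθ).tendsto_atTop) hC
  · obtain ⟨C, θ, hθ, hC⟩ := TNF.exists_subseq_mkState_tendsto hLbdd hH hE hY hZ id
    exact ⟨θ, C, hθ, hC, fun h1 h2 h3 => absurd ⟨h1, h2, h3⟩ hcond⟩
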